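/- **Setting.** Let $\mathcal Z$ be a measurable space, $\mathcal P_1,\dots,\mathcal P_M$ probability distributions on $\mathcal Z$ (one per client), and $\Theta\subset\mathbb R^d$ a nonempty, convex, closed, bounded set with diameter $D$. Let $\ell:\mathbb R^d\times\mathcal Z\to[0,\infty)$ be a loss, measurable in $z$, such that $\ell(\theta;z)\le B$ for all $\theta\in\Theta$, $z\in\mathcal Z$, and such that for every $z$ the function $\ell(\cdot\,;z)$ is convex and $L$-smooth on $\mathbb R^d$ (differentiable with $L$-Lipschitz gradient). Write $\mathcal L_{\mathcal P}(\theta)=\mathbb E_{z\sim\mathcal P}[\ell(\theta;z)]$, $\mathrm{disc}(\mathcal P,\mathcal P')=\sup_{\theta\in\Theta}|\mathcal L_{\mathcal P}(\theta)-\mathcal L_{\mathcal P'}(\theta)|$, $G=\sqrt{2LB}$, and $$\sigma_0^2=\max_m\mathbb E_{z\sim\mathcal P_m}\Big[\sup_{\theta\in\Theta}\|\nabla\ell(\theta;z)-\nabla\mathcal L_{\mathcal P_m}(\theta)\|^2\Big].$$ $\mathrm{VCdim}(\mathcal H)$ denotes the VC dimension of the hypothesis class seen through its losses, i.e. the VC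 dimension of the class of subgraphs $\{(z,r): r<\ell(\theta;z)\}$, $\theta\in\Theta$ (the pseudo-dimension of $\{\ell(\theta;\cdot)\}_{\theta\in\Theta}$). **Historical/fresh scenario.** There are $T\ge1$ rounds and $0\le M_{\rm hist}\le M$. A historical client $m\le M_{\rm hist}$ holds $N_m\ge1$ samples, all in its memory $\mathcal I_m^{(t)}$ in every round $t$. A fresh client $m>M_{\rm hist}$ receives $b_m\ge1$ new samples per round, and its memory in round $t$ consists of exactly those, so $N_m=b_mT$. All samples are independent, those of client $m$ having law $\mathcal P_m$; $\mathcal S=\{z_m^{(j)}\}$ is the set of all of them. Let $N=\sum_mN_m$, $n_m=N_m/N$. Client $m$ gives the constant weight $\lambda_m\ge0$ to each sample in its memory, and the resulting aggregation weights $p_m=\lambda_m|\mathcal I_m^{(t)}|/\sum_{m'}\lambda_{m'}|\mathcal I_{m'}^{(t)}|$ (which do not depend on $t$) form a vector $\bm p$ of the probability simplex. Let $\mathcal L_m^{(t)}(\theta)$ be the average loss over the memory of client $m$ in round $t$, and let $\bar\sigma\ge0$ be defined by $$\bar\sigma^2=\frac1T\sum_{t=1}^T\mathbb E_{\mathcal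 S}\Big[\sup_{\theta\in\Theta}\Big\|\frac1T\sum_{s=1}^T\sum_mp_m\nabla\mathcal L_m^{(s)}(\theta)-\sum_mp_m\nabla\mathcal L_m^{(t)}(\theta)\Big\|^2\Big].$$ **Algorithm.** Start at a fixed $\theta^{(1)}\in\Theta$. In round $t$ every client makes, from $\theta^{(t)}$, $E\ge1$ full-batch gradient steps with learning rate $\eta$ on $\mathcal L_m^{(t)}$, reaching $\theta_m^{(t,E+1)}$; then $\theta^{(t+1)}$ is the projection on $\Theta$ of $\theta^{(t)}+\sum_mp_m(\theta_m^{(t,E+1)}-\theta^{(t)})$. The output is $\bar\theta=\frac1T\sum_{t=1}^T\theta^{(t)}$. The learning rate satisfies $\eta E=\frac{\kappa}{\sqrt T}\min\{1,1/\bar\sigma\}$ for a constant $\kappa>0$ (the minimum is $1$ if $\bar\sigma=0$). **Claim.** Let $\bm\alpha$ be any vector of the probability simplex, $\mathcal P^{(\bm\alpha)}=\sum_m\alpha_m\mathcal P_m$, and suppose that $\mathrm{VCdim}(\mathcal H)$ is finite and at most $N$. Then the true error $\epsilon_{\rm true}=\mathbb E_{\mathcal S}[\mathcal L_{\mathcal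 P^{(\bm\alpha)}}(\bar\theta)]-\min_{\theta\in\Theta}\mathcal L_{\mathcal P^{(\bm\alpha)}}(\theta)$ is well defined (the expectation exists) and $$\begin{aligned}\epsilon_{\rm true}\le{}&\frac{C_1+C_3}{\sqrt T}+\frac{C_2}{\sqrt{T^3}}+\Big(D+\frac2{\sqrt T}\Big)\sigma_0\sqrt{M-M_{\rm hist}}\sqrt{\sum_{m=M_{\rm hist}+1}^Mp_m^2}+2\max_{m,m'}\mathrm{disc}(\mathcal P_m,\mathcal P_{m'})\,\|\bm\alpha-\bm p\|_1\\&+4B\sqrt{1+\log\frac N{\mathrm{VCdim}(\mathcal H)}}\sqrt{\frac{\mathrm{VCdim}(\mathcal H)}N}\sqrt{\sum_{m=1}^M\frac{p_m^2}{n_m}},\end{aligned}$$ (the last term being $0$ if $\mathrm{VCdim}(\mathcal H)=0$), where $C_1,C_2,C_3$ depend on neither $\bm p$, $\bm\alpha$, $T$ nor the sample sizes: $$C_1=\kappa\,G\Big(\tfrac52G+LD\sqrt{2(1-E^{-1})}\Big),\qquad C_2=2\kappa^3L^2G^2(1-E^{-1}),\qquad C_3=\frac{\max\{1,2G\}}{2\kappa}D^2.$$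 -/

import Mathlib

open MeasureTheory

noncomputable section

namespace FedStream

/-- The parameter space `ℝ^d` with its Euclidean norm. -/
abbrev Par (d : ℕ) := EuclideanSpace ℝ (Fin d)

/-! ### VC dimension -/

/-- The class `C` of sets shatters the finite set `s`. -/
def Shatters {α : Type*} (C : Set (Set α)) (s : Finset α) : Prop :=
  ∀ t : Finset α, t ⊆ s → ∃ A ∈ C, ∀ x ∈ s, x ∈ A ↔ x ∈ t

/-- The VC dimension of a class of sets: the supremum of the sizes of its shattered finite sets. -/
def vcDim {α : Type*} (C : Set (Set α)) : ℕ∞ :=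
  ⨆ (s : Finset α) (_ : Shatters C s), (s.card : ℕ∞)

/-- The VC dimension of the hypothesis class `{h_θ : θ ∈ Θ}`, whose members are seen through the
real functions `z ↦ ℓ(θ; z)`: as usual for real-valued functions, it is the VC dimension of the
class of their subgraphs (the pseudo-dimension). -/
def hypVCDim {d : ℕ} {Z : Type*} (ℓ : Par d → Z → ℝ) (Θ : Set (Par d)) : ℕ∞ :=
  vcDim {A : Set (Z × ℝ) | ∃ θ ∈ Θ, A = {x | x.2 < ℓ θ x.1}}

/-! ### Risks, discrepancy, gradient noise -/

section Risk

variable {d M : ℕ} {Z : Type*} [MeasurableSpace Z]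

/-- The expected risk of `θ` under the distribution `P`. -/
def risk (ℓ : Par d → Z → ℝ) (P : Measure Z) (θ : Par d) : ℝ := ∫ z, ℓ θ z ∂P

/-- The mixture `∑ₘ αₘ Pₘ`. -/
def mixture (α : Fin M → ℝ) (P : Fin M → Measure Z) : Measure Z :=
  ∑ m, ENNReal.ofReal (α m) • P m

/-- The (label) discrepancy of two distributions. -/
def disc (ℓ : Par d → Z → ℝ) (Θ : Set (Par d)) (P P' : Measure Z) : ℝ :=
  ⨆ θ : Θ, |risk ℓ P θ - risk ℓ P' θ|

/-- The largest discrepancy between two clients. -/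
def maxDisc (ℓ : Par d → Z → ℝ) (Θ : Set (Par d)) (P : Fin M → Measure Z) : ℝ :=
  ⨆ m, ⨆ m', disc ℓ Θ (P m) (P m')

/-- `σ₀`, where
`σ₀² = maxₘ 𝔼_{z ∼ Pₘ} [sup_{θ ∈ Θ} ‖∇ℓ(θ; z) - ∇L_{Pₘ}(θ)‖²]`. -/
def sigmaZero (ℓ : Par d → Z → ℝ) (Θ : Set (Par d)) (P : Fin M → Measure Z) : ℝ :=
  √(⨆ m, ∫ z, (⨆ θ : Θ,
      ‖gradient (fun x => ℓ x z) (θ : Par d) - gradient (risk ℓ (P m)) (θ : Par d)‖ ^ 2) ∂(P m))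

end Risk

/-- `f` is `L`-smooth on `ℝ^d`: differentiable with `L`-Lipschitz gradient. -/
def IsSmooth {d : ℕ} (L : NNReal) (f : Par d → ℝ) : Prop :=
  Differentiable ℝ f ∧ LipschitzWith L (gradient f)

open Classical in
/-- Euclidean projection on `Θ`: the point of `Θ` nearest to `x` (it exists and is unique when `Θ`
is closed, convex and nonempty). -/
def proj {d : ℕ} (Θ : Set (Par d)) (x : Par d) : Par d :=
  if h : ∃ y ∈ Θ, dist x y = Metric.infDist x Θ then h.choose else x

/-! ### Memories, weights and the federated algorithm -/

/-- A deterministic memory and weight schedule over `T` rounds for `M` clients: client `m` gathers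
`size m` samples in total; `mem t m` is the set of the indices of those that are in its memory in
round `t`, and `wt t m j` is the weight `λ_m^{(t,j)}` of sample `j` in that round. -/
structure Schedule (M T : ℕ) where
  size : Fin M → ℕ
  mem : Fin T → (m : Fin M) → Finset (Fin (size m))
  wt : Fin T → (m : Fin M) → Fin (size m) → ℝ

namespace Schedule

variable {d M T : ℕ} {Z : Type*} (W : Schedule M T)

/-- Training datasets: the `j`-th sample of client `m` is `S ⟨m, j⟩`. -/
abbrev Dataset (Z : Type*) : Type _ := ((m : Fin M) × Fin (W.size m)) → Z

/-- The law of the training dataset: all samples are independent, those of client `m` have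
distribution `P m`. -/
def law [MeasurableSpace Z] (P : Fin M → Measure Z) : Measure (W.Dataset Z) :=
  Measure.pi fun i : (m : Fin M) × Fin (W.size m) => P i.1

/-- Total number `N` of samples. -/
def total : ℕ := ∑ m, W.size m

/-- Relative size `n_m = N_m / N` of the dataset of client `m`. -/
def relSize (m : Fin M) : ℝ := (W.size m : ℝ) / (W.total : ℝ)

/-- Total weight in the memory of client `m` in round `t`. -/
def memWt (t : Fin T) (m : Fin M) : ℝ := ∑ j ∈ W.mem t m, W.wt t m j

/-- Aggregation weight `p_m^{(t)}`. -/
def aggWt (t : Fin T) (m : Fin M) : ℝ := W.memWt t m / ∑ m', W.memWt t m'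

/-- Round weight `q^{(t)}`. -/
def roundWt (t : Fin T) : ℝ := (∑ m, W.memWt t m) / ∑ s, ∑ m, W.memWt s m

/-- Weighted local objective of client `m` in round `t`. -/
def localRisk (ℓ : Par d → Z → ℝ) (S : W.Dataset Z) (t : Fin T) (m : Fin M) (θ : Par d) : ℝ :=
  (∑ j ∈ W.mem t m, W.wt t m j * ℓ θ (S ⟨m, j⟩)) / W.memWt t m

/-- Global weighted empirical risk. -/
def globalRisk (ℓ : Par d → Z → ℝ) (S : W.Dataset Z) (θ : Par d) : ℝ :=
  (∑ m, ∑ t, ∑ j ∈ W.mem t m, W.wt t m j * ℓ θ (S ⟨m, j⟩)) / ∑ t, ∑ m, W.memWt t m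

/-- `σ̄(λ)`, where
`σ̄²(λ) = ∑ₜ q^{(t)} 𝔼_S [sup_{θ ∈ Θ} ‖∇L_S^{(λ)}(θ) - ∑ₘ p_m^{(t)} ∇L_{M_m^{(t)}}^{(λ)}(θ)‖²]`. -/
def sigmaBar [MeasurableSpace Z] (ℓ : Par d → Z → ℝ) (Θ : Set (Par d))
    (P : Fin M → Measure Z) : ℝ :=
  √(∑ t, W.roundWt t * ∫ S, (⨆ θ : Θ,
      ‖gradient (W.globalRisk ℓ S) (θ : Par d)
        - ∑ m, W.aggWt t m • gradient (W.localRisk ℓ S t m) (θ : Par d)‖ ^ 2) ∂(W.law P))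

/-- The full-batch weighted gradient that client `m` computes at `x` in round `t`. -/
def batchGrad (ℓ : Par d → Z → ℝ) (S : W.Dataset Z) (t : Fin T) (m : Fin M) (x : Par d) : Par d :=
  ∑ j ∈ W.mem t m, (W.wt t m j / W.memWt t m) • gradient (fun y => ℓ y (S ⟨m, j⟩)) x

/-- The model of client `m` after `E` local gradient steps with learning rate `η` in round `t`,
started at `x`. -/
def localModel (ℓ : Par d → Z → ℝ) (η : ℝ) (E : ℕ) (S : W.Dataset Z) (t : Fin T) (m : Fin M)
    (x : Par d) : Par d :=
  (fun y => y - η • W.batchGrad ℓ S t m y)^[E] x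

/-- The global models under full client participation: `model … k` is the model broadcast in the
round of index `k` (rounds have the indices `0, …, T - 1`), `θ₁` is the initial model. -/
def model (ℓ : Par d → Z → ℝ) (Θ : Set (Par d)) (η : ℝ) (E : ℕ) (θ₁ : Par d) (S : W.Dataset Z) :
    ℕ → Par d
  | 0 => θ₁
  | k + 1 =>
    let x := model ℓ Θ η E θ₁ S k
    if h : k < T then
      proj Θ (x + ∑ m, W.aggWt ⟨k, h⟩ m • (W.localModel ℓ η E S ⟨k, h⟩ m x - x))
    else x

/-- The output `∑ₜ q^{(t)} θ^{(t)}` of the algorithm. -/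
def output (ℓ : Par d → Z → ℝ) (Θ : Set (Par d)) (η : ℝ) (E : ℕ) (θ₁ : Par d)
    (S : W.Dataset Z) : Par d :=
  ∑ t : Fin T, W.roundWt t • W.model ℓ Θ η E θ₁ S t

/-- The true error `𝔼_S [L_P(output(S))] - min_{θ ∈ Θ} L_P(θ)` for the target `P = ∑ₘ αₘ Pₘ`. -/
def trueError [MeasurableSpace Z] (ℓ : Par d → Z → ℝ) (Θ : Set (Par d)) (P : Fin M → Measure Z)
    (α : Fin M → ℝ) (η : ℝ) (E : ℕ) (θ₁ : Par d) : ℝ :=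
  (∫ S, risk ℓ (mixture α P) (W.output ℓ Θ η E θ₁ S) ∂(W.law P))
    - ⨅ θ : Θ, risk ℓ (mixture α P) θ

end Schedule

/-- The historical/fresh scenario. The clients of index `< Mhist` are historical: client `m` has
`c m` samples, which stay in its memory in all rounds. The other clients are fresh: client `m`
receives `c m` new samples in every round and keeps only those. All samples of client `m` have
weight `lam m` whenever they are in memory. -/
def histFresh {M : ℕ} (T Mhist : ℕ) (c : Fin M → ℕ) (lam : Fin M → ℝ) : Schedule M T where
  size m := if (m : ℕ) < Mhist then c m else c m * T
  mem t m := Finset.univ.filter fun j =>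
    (m : ℕ) < Mhist ∨ ((t : ℕ) * c m ≤ (j : ℕ) ∧ (j : ℕ) < ((t : ℕ) + 1) * c m)
  wt _ m _ := lam m

/-! ### Constants -/

/-- The bound `G = √(2LB)` on the gradients. -/
def gradBound (L : NNReal) (B : ℝ) : ℝ := √(2 * L * B)

/-- `C₁` for the effective learning rate `ηE = κ T^{-1/2} min{1, 1/σ̄}`. -/
def constOne (κ : ℝ) (L : NNReal) (B D : ℝ) (E : ℕ) : ℝ :=
  κ * (gradBound L B * (5 / 2 * gradBound L B + L * D * √(2 * (1 - (E : ℝ)⁻¹))))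

/-- `C₂` for the effective learning rate `ηE = κ T^{-1/2} min{1, 1/σ̄}`. -/
def constTwo (κ : ℝ) (L : NNReal) (B : ℝ) (E : ℕ) : ℝ :=
  κ ^ 3 * (2 * (L : ℝ) ^ 2 * gradBound L B ^ 2 * (1 - (E : ℝ)⁻¹))

/-- `C₃` for the effective learning rate `ηE = κ T^{-1/2} min{1, 1/σ̄}`; it is proportional to
`D²`, and `2 G` is the a priori bound on `σ̄`. -/
def constThree (κ : ℝ) (L : NNReal) (B D : ℝ) : ℝ :=
  max 1 (2 * gradBound L B) / (2 * κ) * D ^ 2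

end FedStream

end

open MeasureTheory

noncomputable section

namespace FedStream

/-! ### Calculus of smooth convex functions -/

section Calculus

open Set Metric

variable {d : ℕ}

/-! Let `u` minimise the target risk over `Θ`, and consider the empirical risk in which each sample
of client `m` has weight `p m / size m`; it is the average over the rounds of the risks `F t` that
the algorithm sees (`histFresh_globalRisk`). Passing from `α` to `p` costs the discrepancy twice, at
the output and at `u` (`IsLoss.excess_risk_le`). What remains is the generalization gap at the
output, the optimization error on the dataset, and the deviation of the empirical risk at the fixed
point `u`, which has mean zero. `IsLoss.trueError_le` adds these up.

Generalization (`IsLoss.integral_gap_le`). A ghost sample and a supremum over `Θ` remove the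
dependence of the output on the data, and exchanging samples with their ghosts introduces random
signs. For fixed samples each loss is the integral over levels `r` in `[0, B]` of the indicator of
its subgraph. At one level, Sauer–Shelah leaves at most `exp H` patterns, with `H = v (1 + log (N /
v))`, and Massart's finite-class bound gives `√(2 H ∑ w²)`. Integration over the levels contributes
the factor `B`; no chaining is needed.

Optimization (`Schedule.optimization_error_le`). This part holds for every dataset. A nonnegative
`L`-smooth `f` satisfies `‖∇f‖² ≤ 2 L f`, so gradients are at most `G` wherever values are at most
`B`, and descent keeps the unprojected local iterates there. A round is then a projected gradient
step of length `η E` on `F t`, up to an error of second order in `η E`, and telescoping squared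
distances to `u` bounds the regret. If the local steps are too long for descent, the trivial bound
`G D` is already below `C₁ / √T`.

Regret concerns the `F t`, not their average. The difference is a double sum of `F s (x t) - F t (x
t)`: historical clients cancel, and exchanging the indices leaves `Y s (x t) - Y s (x s)`, where `Y
s` is the centred fresh part. This is at most `D` times a Lipschitz constant whose mean is
controlled by `σ₀` and Cauchy–Schwarz over the fresh clients, so the dependence of the iterates on
the samples does no harm. The quantity `σ̄` matters only through the step size and the bound `σ̄ ≤ 2
G`. -/

theorem hasDerivAt_comp_line {f : Par d → ℝ} (hf : Differentiable ℝ f) (x v : Par d) (t : ℝ) :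
    HasDerivAt (fun s : ℝ => f (x + s • v)) (inner ℝ (gradient f (x + t • v)) v) t := by
  have h1 : HasDerivAt (fun s : ℝ => x + s • v) v t := by
    simpa using ((hasDerivAt_id t).smul_const v).const_add x
  exact (hf (x + t • v)).hasGradientAt.hasFDerivAt.comp_hasDerivAt t h1

theorem IsSmooth.le_quadratic {L : NNReal} {f : Par d → ℝ} (hf : IsSmooth L f) (x v : Par d) :
    f (x + v) ≤ f x + inner ℝ (gradient f x) v + L / 2 * ‖v‖ ^ 2 := by
  -- Difference of the two sides along the segment; its derivative is nonpositive because the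
  -- gradient is Lipschitz.
  set g : ℝ → ℝ := fun t => f (x + t • v) - t * inner ℝ (gradient f x) v - L / 2 * t ^ 2 * ‖v‖ ^ 2
  have hg : ∀ t, HasDerivAt g (inner ℝ (gradient f (x + t • v)) v - inner ℝ (gradient f x) v
      - L * t * ‖v‖ ^ 2) t := by
    intro t
    have h1 := hasDerivAt_comp_line hf.1 x v t
    have h2 := (hasDerivAt_id t).mul_const (inner ℝ (gradient f x) v)
    have h3 := (((hasDerivAt_id t).pow 2).const_mul ((L : ℝ) / 2)).mul_const (‖v‖ ^ 2)
    refine ((h1.sub h2).sub h3).congr_deriv ?_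
    simp only [id_eq, Nat.cast_ofNat, Nat.add_one_sub_one, pow_one]
    ring
  have hanti : AntitoneOn g (Icc 0 1) := by
    refine antitoneOn_of_deriv_nonpos (convex_Icc 0 1)
      (fun t _ => (hg t).continuousAt.continuousWithinAt)
      (fun t _ => (hg t).differentiableAt.differentiableWithinAt) ?_
    intro t ht
    rw [interior_Icc] at ht
    rw [(hg t).deriv, ← inner_sub_left]
    have h1 : ‖gradient f (x + t • v) - gradient f x‖ ≤ L * (t * ‖v‖) := by
      have := hf.2.dist_le_mul (x + t • v) x
      rw [dist_eq_norm, dist_eq_norm, add_sub_cancel_left, norm_smul, Real.norm_eq_abs,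
        abs_of_pos ht.1] at this
      exact this
    have h2 := real_inner_le_norm (gradient f (x + t • v) - gradient f x) v
    have h3 := mul_le_mul_of_nonneg_right h1 (norm_nonneg v)
    nlinarith
  have := hanti (left_mem_Icc.2 zero_le_one) (right_mem_Icc.2 zero_le_one) zero_le_one
  simp only [g, one_smul, zero_smul, add_zero, one_mul, one_pow, mul_one, zero_mul, sub_zero] at this
  linarith

theorem IsSmooth.gradient_step {L : NNReal} {f : Par d → ℝ} (hf : IsSmooth L f) (x : Par d)
    (η : ℝ) : f (x - η • gradient f x) ≤ f x - η * (1 - L * η / 2) * ‖gradient f x‖ ^ 2 := by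
  have h := hf.le_quadratic x (-(η • gradient f x))
  rw [← sub_eq_add_neg, inner_neg_right, inner_smul_right, real_inner_self_eq_norm_sq, norm_neg,
    norm_smul, mul_pow, Real.norm_eq_abs, sq_abs] at h
  nlinarith

/-- A gradient step cannot bring `f` below 0, so its guaranteed decrease is at most `f x`; the step
`1 / L` makes this decrease largest. -/
theorem IsSmooth.norm_gradient_sq_le {L : NNReal} {f : Par d → ℝ} (hf : IsSmooth L f)
    (hnonneg : ∀ x, 0 ≤ f x) (x : Par d) : ‖gradient f x‖ ^ 2 ≤ 2 * L * f x := by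
  have key : ∀ η : ℝ, η * (1 - L * η / 2) * ‖gradient f x‖ ^ 2 ≤ f x := fun η => by
    linarith [hf.gradient_step x η, hnonneg (x - η • gradient f x)]
  rcases eq_or_lt_of_le L.coe_nonneg with h0 | hpos
  -- For `L = 0` the decrease is linear in the step, so a nonzero gradient and a long step
  -- contradict nonnegativity.
  · rw [← h0] at key ⊢
    by_contra! hlt
    have hlt' : 0 < ‖gradient f x‖ ^ 2 := by simpa using hlt
    have := key ((f x + 1) / ‖gradient f x‖ ^ 2)
    simp only [zero_mul, zero_div, sub_zero, mul_one] at this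
    rw [div_mul_cancel₀ _ hlt'.ne'] at this
    linarith
  · have h := mul_le_mul_of_nonneg_left (key (1 / L)) (by positivity : (0 : ℝ) ≤ 2 * L)
    refine le_trans (le_of_eq ?_) h
    field_simp
    ring

theorem IsSmooth.norm_gradient_le {L : NNReal} {f : Par d → ℝ} (hf : IsSmooth L f)
    (hnonneg : ∀ x, 0 ≤ f x) {x : Par d} {B : ℝ} (hx : f x ≤ B) :
    ‖gradient f x‖ ≤ gradBound L B := by
  refine Real.le_sqrt_of_sq_le ((hf.norm_gradient_sq_le hnonneg x).trans ?_)
  gcongr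

theorem gradBound_nonneg (L : NNReal) (B : ℝ) : 0 ≤ gradBound L B := Real.sqrt_nonneg _

theorem hasGradientAt_sum_mul {ι : Type*} (s : Finset ι) (a : ι → ℝ) {f : ι → Par d → ℝ}
    (hf : ∀ i ∈ s, Differentiable ℝ (f i)) (x : Par d) :
    HasGradientAt (fun y => ∑ i ∈ s, a i * f i y) (∑ i ∈ s, a i • gradient (f i) x) x := by
  rw [hasGradientAt_iff_hasFDerivAt, map_sum]
  refine HasFDerivAt.fun_sum fun i hi => ?_
  rw [map_smul]
  exact ((hf i hi x).hasGradientAt.hasFDerivAt).const_mul (a i)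

theorem hasGradientAt_sub {f g : Par d → ℝ} {x f' g' : Par d} (hf : HasGradientAt f f' x)
    (hg : HasGradientAt g g' x) : HasGradientAt (fun y => f y - g y) (f' - g') x := by
  rw [hasGradientAt_iff_hasFDerivAt, map_sub]
  exact hf.hasFDerivAt.sub hg.hasFDerivAt

/-- A total weight below 1 must be allowed: in a memory of weight zero the normalised weights are `0
/ 0 = 0`. -/
theorem IsSmooth.sum_mul {ι : Type*} {s : Finset ι} {a : ι → ℝ} {f : ι → Par d → ℝ} {L : NNReal}
    (hf : ∀ i ∈ s, IsSmooth L (f i)) (ha : ∀ i ∈ s, 0 ≤ a i) (hs : ∑ i ∈ s, a i ≤ 1) :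
    IsSmooth L (fun y => ∑ i ∈ s, a i * f i y) := by
  have hg := hasGradientAt_sum_mul s a fun i hi => (hf i hi).1
  refine ⟨fun x => (hg x).differentiableAt, LipschitzWith.of_dist_le_mul fun x y => ?_⟩
  rw [(hg x).gradient, (hg y).gradient, dist_eq_norm, ← Finset.sum_sub_distrib]
  calc ‖∑ i ∈ s, (a i • gradient (f i) x - a i • gradient (f i) y)‖
      ≤ ∑ i ∈ s, a i * (L * dist x y) := by
        refine norm_sum_le_of_le s fun i hi => ?_
        rw [← smul_sub, norm_smul, Real.norm_of_nonneg (ha i hi), ← dist_eq_norm]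
        exact mul_le_mul_of_nonneg_left ((hf i hi).2.dist_le_mul x y) (ha i hi)
    _ ≤ L * dist x y := by
        rw [← Finset.sum_mul]
        exact mul_le_of_le_one_left (by positivity) hs

theorem convexOn_sum_mul {ι : Type*} {s : Finset ι} {a : ι → ℝ} {f : ι → Par d → ℝ}
    (hf : ∀ i ∈ s, ConvexOn ℝ univ (f i)) (ha : ∀ i ∈ s, 0 ≤ a i) :
    ConvexOn ℝ univ (fun y => ∑ i ∈ s, a i * f i y) := by
  classical
  induction s using Finset.induction_on with
  | empty => simpa using convexOn_const (0 : ℝ) (convex_univ (E := Par d))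
  | insert i s hi ih =>
    simp only [Finset.sum_insert hi]
    exact ((hf i (by simp)).smul (ha i (by simp))).add
      (ih (fun j hj => hf j (by simp [hj])) fun j hj => ha j (by simp [hj]))

theorem sub_le_inner_gradient {f : Par d → ℝ} (hf : Differentiable ℝ f)
    (hc : ConvexOn ℝ univ f) (x y : Par d) : f x - f y ≤ inner ℝ (gradient f x) (x - y) := by
  have hline : ConvexOn ℝ univ (fun t : ℝ => f (x + t • (y - x))) := by
    have := hc.comp_affineMap (AffineMap.lineMap x y : ℝ →ᵃ[ℝ] Par d)
    refine this.congr fun t _ => ?_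
    simp [AffineMap.lineMap_apply, add_comm]
  have h := hline.le_slope_of_hasDerivAt (mem_univ 0) (mem_univ 1) one_pos
    (hasDerivAt_comp_line hf x (y - x) 0)
  simp only [slope_def_field, zero_smul, add_zero, one_smul, add_sub_cancel, sub_zero,
    div_one] at h
  have h2 : inner ℝ (gradient f x) (x - y) = - inner ℝ (gradient f x) (y - x) := by
    rw [← inner_neg_right, neg_sub]
  linarith

theorem abs_sub_le_of_norm_gradient_le {Θ : Set (Par d)} (hconv : Convex ℝ Θ) {f : Par d → ℝ}
    (hf : Differentiable ℝ f) {C : ℝ} (hC : ∀ x ∈ Θ, ‖gradient f x‖ ≤ C) {x y : Par d}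
    (hx : x ∈ Θ) (hy : y ∈ Θ) : |f y - f x| ≤ C * ‖y - x‖ := by
  refine hconv.norm_image_sub_le_of_norm_hasFDerivWithin_le
    (fun z _ => (hf z).hasGradientAt.hasFDerivAt.hasFDerivWithinAt) (fun z hz => ?_) hx hy
  rw [LinearIsometryEquiv.norm_map]
  exact hC z hz

end Calculus

/-! ### Projection -/

section Projection

open Set Metric

variable {d : ℕ} {Θ : Set (Par d)}

theorem proj_spec (hclosed : IsClosed Θ) (hne : Θ.Nonempty) (x : Par d) :
    proj Θ x ∈ Θ ∧ dist x (proj Θ x) = infDist x Θ := by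
  have h : ∃ y ∈ Θ, dist x y = infDist x Θ := by
    obtain ⟨y, hy, h⟩ := hclosed.exists_infDist_eq_dist hne x
    exact ⟨y, hy, h.symm⟩
  rw [proj, dif_pos h]
  exact h.choose_spec

theorem proj_mem (hclosed : IsClosed Θ) (hne : Θ.Nonempty) (x : Par d) : proj Θ x ∈ Θ :=
  (proj_spec hclosed hne x).1

theorem inner_sub_proj_le (hconv : Convex ℝ Θ) (hclosed : IsClosed Θ) (hne : Θ.Nonempty)
    (x : Par d) {y : Par d} (hy : y ∈ Θ) : inner ℝ (x - proj Θ x) (y - proj Θ x) ≤ 0 := by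
  obtain ⟨h1, h2⟩ := proj_spec hclosed hne x
  refine (norm_eq_iInf_iff_real_inner_le_zero hconv h1).1 ?_ y hy
  rw [← dist_eq_norm, h2, infDist_eq_iInf]
  simp only [dist_eq_norm]

theorem norm_proj_sub_sq_le (hconv : Convex ℝ Θ) (hclosed : IsClosed Θ) (hne : Θ.Nonempty)
    (x : Par d) {y : Par d} (hy : y ∈ Θ) : ‖proj Θ x - y‖ ^ 2 ≤ ‖x - y‖ ^ 2 := by
  have h := inner_sub_proj_le hconv hclosed hne x hy
  have h2 := norm_add_sq_real (x - proj Θ x) (proj Θ x - y)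
  rw [sub_add_sub_cancel] at h2
  have h3 : inner ℝ (x - proj Θ x) (proj Θ x - y) = - inner ℝ (x - proj Θ x) (y - proj Θ x) := by
    rw [← inner_neg_right, neg_sub]
  nlinarith [sq_nonneg ‖x - proj Θ x‖]

/-- Adding the variational inequalities at the two projections gives the bound. It serves to make
the iterates measurable in the dataset. -/
theorem lipschitzWith_proj (hconv : Convex ℝ Θ) (hclosed : IsClosed Θ) (hne : Θ.Nonempty) :
    LipschitzWith 1 (proj Θ) := by
  refine LipschitzWith.of_dist_le_mul fun x y => ?_
  rw [NNReal.coe_one, one_mul, dist_eq_norm, dist_eq_norm]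
  have h1 := inner_sub_proj_le hconv hclosed hne x (proj_mem hclosed hne y)
  have h2 := inner_sub_proj_le hconv hclosed hne y (proj_mem hclosed hne x)
  set u := proj Θ x
  set v := proj Θ y
  have h3 : ‖u - v‖ ^ 2 ≤ inner ℝ (x - y) (u - v) := by
    have h4 : inner ℝ (x - y) (u - v)
        = ‖u - v‖ ^ 2 - inner ℝ (x - u) (v - u) - inner ℝ (y - v) (u - v) := by
      rw [← real_inner_self_eq_norm_sq, ← neg_sub u v, inner_neg_right, sub_neg_eq_add,
        ← inner_add_left, ← inner_sub_left]
      congr 1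
      abel
    linarith
  have h5 := real_inner_le_norm (x - y) (u - v)
  rcases eq_or_lt_of_le (norm_nonneg (u - v)) with h | h
  · rw [← h]; positivity
  · nlinarith

end Projection

/-! ### The Sauer–Shelah bound for traces on finite samples -/

section Sauer

variable {ι α : Type*} [DecidableEq ι]

/-- Two indices carrying the same point are never separated by a trace. Hence `x` is injective on a
shattered index set, and the image is shattered and has the same size. -/
theorem vcDim_traces_le {C : Set (Set α)} {v : ℕ} (hv : vcDim C ≤ v) (x : ι → α)
    {𝒜 : Finset (Finset ι)} (h𝒜 : ∀ a ∈ 𝒜, ∃ A ∈ C, ∀ i, i ∈ a ↔ x i ∈ A) : 𝒜.vcDim ≤ v := by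
  classical
  refine Finset.sup_le fun s hs => ?_
  rw [Finset.mem_shatterer] at hs
  have hinj : Set.InjOn x s := by
    intro i hi j hj hij
    by_contra hne
    obtain ⟨u, hu, hsu⟩ := hs.exists_inter_eq_singleton hi
    obtain ⟨A, -, hA⟩ := h𝒜 u hu
    have hiu : i ∈ s ∩ u := by rw [hsu]; exact Finset.mem_singleton_self i
    have hju : j ∈ s ∩ u :=
      Finset.mem_inter.2 ⟨hj, (hA j).2 (hij ▸ (hA i).1 (Finset.mem_inter.1 hiu).2)⟩
    rw [hsu, Finset.mem_singleton] at hju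
    exact hne hju.symm
  have hsh : Shatters C (s.image x) := by
    intro t _
    obtain ⟨u, hu, hsu⟩ := hs (Finset.filter_subset (fun i => x i ∈ t) s)
    obtain ⟨A, hAC, hA⟩ := h𝒜 u hu
    refine ⟨A, hAC, fun y hy => ?_⟩
    obtain ⟨i, hi, rfl⟩ := Finset.mem_image.1 hy
    rw [← hA i]
    have := Finset.ext_iff.1 hsu i
    simp only [Finset.mem_inter, Finset.mem_filter, hi, true_and] at this
    exact this
  have h1 : ((s.image x).card : ℕ∞) ≤ vcDim C :=
    le_iSup₂_of_le (f := fun (s : Finset α) (_ : Shatters C s) => (s.card : ℕ∞)) _ hsh le_rfl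
  rw [Finset.card_image_of_injOn hinj] at h1
  exact_mod_cast h1.trans hv

/-- With `q = v / n ≤ 1`, one has `q ^ v ≤ q ^ k` for `k ≤ v`, and the binomial theorem bounds the
weighted sum by `(1 + q) ^ n ≤ exp v`. -/
theorem sum_choose_le_exp {n v : ℕ} (hvn : v ≤ n) :
    (∑ k ∈ Finset.Iic v, (n.choose k : ℝ)) ≤ Real.exp (v * (1 + Real.log (n / v))) := by
  rcases Nat.eq_zero_or_pos v with rfl | hv
  · simp [show Finset.Iic 0 = {0} from rfl]
  have hn : 0 < n := hv.trans_le hvn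
  have hv' : (0 : ℝ) < v := by exact_mod_cast hv
  have hn' : (0 : ℝ) < n := by exact_mod_cast hn
  set q : ℝ := v / n
  have hq0 : 0 < q := by positivity
  have hq1 : q ≤ 1 := (div_le_one hn').2 (by exact_mod_cast hvn)
  have h1 : q ^ v * ∑ k ∈ Finset.Iic v, (n.choose k : ℝ) ≤ Real.exp v := by
    calc q ^ v * ∑ k ∈ Finset.Iic v, (n.choose k : ℝ)
        ≤ ∑ k ∈ Finset.Iic v, q ^ k * (n.choose k : ℝ) := by
          rw [Finset.mul_sum]
          refine Finset.sum_le_sum fun k hk => ?_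
          exact mul_le_mul_of_nonneg_right
            (pow_le_pow_of_le_one hq0.le hq1 (Finset.mem_Iic.1 hk)) (Nat.cast_nonneg _)
      _ ≤ ∑ k ∈ Finset.range (n + 1), q ^ k * (n.choose k : ℝ) := by
          refine Finset.sum_le_sum_of_subset_of_nonneg ?_ fun k _ _ => by positivity
          intro k hk
          rw [Finset.mem_Iic] at hk
          rw [Finset.mem_range]
          omega
      _ = (q + 1) ^ n := by
          rw [add_pow]
          simp
      _ ≤ Real.exp q ^ n := by
          gcongr
          exact Real.add_one_le_exp q
      _ = Real.exp v := by
          rw [← Real.exp_nat_mul, mul_div_cancel₀ _ hn'.ne']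
  have h2 : Real.exp (v * (1 + Real.log (n / v))) = Real.exp v / q ^ v := by
    rw [mul_add, mul_one, Real.exp_add, Real.exp_nat_mul, Real.exp_log (by positivity),
      div_eq_mul_inv (Real.exp _), ← inv_pow, inv_div]
  rw [h2, le_div_iff₀ (by positivity), mul_comm]
  exact h1

theorem card_traces_le_exp [Fintype ι] {C : Set (Set α)} {v : ℕ} (hv : vcDim C ≤ v)
    (hvn : v ≤ Fintype.card ι) (x : ι → α) {𝒜 : Finset (Finset ι)}
    (h𝒜 : ∀ a ∈ 𝒜, ∃ A ∈ C, ∀ i, i ∈ a ↔ x i ∈ A) :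
    (𝒜.card : ℝ) ≤ Real.exp (v * (1 + Real.log (Fintype.card ι / v))) := by
  refine le_trans ?_ (sum_choose_le_exp hvn)
  have h1 : 𝒜.card ≤ ∑ k ∈ Finset.Iic v, (Fintype.card ι).choose k := by
    refine 𝒜.card_le_card_shatterer.trans (Finset.card_shatterer_le_sum_vcDim.trans ?_)
    exact Finset.sum_le_sum_of_subset (Finset.Iic_subset_Iic.2 (vcDim_traces_le hv x h𝒜))
  exact_mod_cast h1

end Sauer

/-! ### Rademacher averages -/

section Rademacher

variable {ι : Type*} [Fintype ι] [DecidableEq ι]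

/-- The sign `±1` of a Boolean. -/
def sgn (b : Bool) : ℝ := if b then 1 else -1

/-- The average over all sign patterns. -/
def signAvg (X : (ι → Bool) → ℝ) : ℝ := ((2 : ℝ) ^ Fintype.card ι)⁻¹ * ∑ σ, X σ

theorem signAvg_mono {X Y : (ι → Bool) → ℝ} (h : ∀ σ, X σ ≤ Y σ) : signAvg X ≤ signAvg Y :=
  mul_le_mul_of_nonneg_left (Finset.sum_le_sum fun σ _ => h σ) (by positivity)

theorem signAvg_const (c : ℝ) : signAvg (fun _ : ι → Bool => c) = c := by
  simp [signAvg]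

theorem signAvg_add (X Y : (ι → Bool) → ℝ) :
    signAvg (fun σ => X σ + Y σ) = signAvg X + signAvg Y := by
  simp [signAvg, Finset.sum_add_distrib, mul_add]

/-- The average factors over the coordinates into hyperbolic cosines. -/
theorem signAvg_exp_le (u : ι → ℝ) :
    signAvg (fun σ => Real.exp (∑ i, sgn (σ i) * u i)) ≤ Real.exp ((∑ i, u i ^ 2) / 2) := by
  have h : signAvg (fun σ => Real.exp (∑ i, sgn (σ i) * u i)) = ∏ i, Real.cosh (u i) := by
    have h1 := Finset.prod_univ_sum (fun _ : ι => (Finset.univ : Finset Bool))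
      (fun i b => Real.exp (sgn b * u i))
    rw [Fintype.piFinset_univ] at h1
    simp only [signAvg, Real.exp_sum]
    rw [← h1]
    rw [← Finset.card_univ, ← Finset.prod_const, ← Finset.prod_inv_distrib,
      ← Finset.prod_mul_distrib]
    refine Finset.prod_congr rfl fun i _ => ?_
    simp only [Fintype.sum_bool, sgn, if_true, Real.cosh_eq]
    norm_num
    ring
  rw [h, Finset.sum_div, Real.exp_sum]
  exact Finset.prod_le_prod (fun i _ => (Real.cosh_pos _).le)
    fun i _ => Real.cosh_le_exp_half_sq _

/-- Massart's argument: the pattern may depend on the signs, so the exponential of its sum is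
bounded by the sum of the exponentials over all patterns; Jensen and the subgaussian bound conclude.
-/
theorem signAvg_le_of_card_le {𝒜 : Finset (Finset ι)} {H : ℝ} (hcard : (𝒜.card : ℝ) ≤ Real.exp H)
    {g : (ι → Bool) → Finset ι} (hg : ∀ σ, g σ ∈ 𝒜) (w : ι → ℝ) {t : ℝ} (ht : 0 < t) :
    signAvg (fun σ => ∑ i ∈ g σ, sgn (σ i) * w i) ≤ H / t + t * (∑ i, w i ^ 2) / 2 := by
  set X : (ι → Bool) → ℝ := fun σ => ∑ i ∈ g σ, sgn (σ i) * w i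
  have hjensen : Real.exp (t * signAvg X) ≤ signAvg fun σ => Real.exp (t * X σ) := by
    have h := convexOn_exp.map_sum_le (t := Finset.univ)
      (w := fun _ : ι → Bool => ((2 : ℝ) ^ Fintype.card ι)⁻¹) (p := fun σ => t * X σ)
      (fun _ _ => by positivity) (by simp) (fun _ _ => Set.mem_univ _)
    simp only [smul_eq_mul] at h
    rw [← Finset.mul_sum, ← Finset.mul_sum, ← Finset.mul_sum] at h
    refine le_trans (le_of_eq ?_) h
    unfold signAvg
    ring_nf
  have hbound : (signAvg fun σ => Real.exp (t * X σ))
      ≤ Real.exp (H + t ^ 2 * (∑ i, w i ^ 2) / 2) := by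
    calc (signAvg fun σ => Real.exp (t * X σ))
        ≤ signAvg fun σ => ∑ a ∈ 𝒜,
            Real.exp (∑ i, sgn (σ i) * (if i ∈ a then t * w i else 0)) := by
          refine signAvg_mono fun σ => ?_
          have h := Finset.single_le_sum (s := 𝒜)
            (f := fun a => Real.exp (∑ i, sgn (σ i) * (if i ∈ a then t * w i else 0)))
            (fun a _ => (Real.exp_pos _).le) (hg σ)
          refine le_trans (le_of_eq ?_) h
          simp only [X, mul_ite, mul_zero, Finset.sum_ite_mem, Finset.univ_inter, Finset.mul_sum]
          congr 1
          exact Finset.sum_congr rfl fun i _ => by ring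
      _ = ∑ a ∈ 𝒜, signAvg fun σ =>
            Real.exp (∑ i, sgn (σ i) * (if i ∈ a then t * w i else 0)) := by
          simp only [signAvg, Finset.mul_sum]
          exact Finset.sum_comm
      _ ≤ ∑ a ∈ 𝒜, Real.exp (t ^ 2 * (∑ i, w i ^ 2) / 2) := by
          refine Finset.sum_le_sum fun a _ => (signAvg_exp_le _).trans ?_
          rw [Real.exp_le_exp, Finset.mul_sum]
          gcongr with i
          split_ifs
          · rw [mul_pow]
          · rw [zero_pow two_ne_zero]; positivity
      _ ≤ Real.exp (H + t ^ 2 * (∑ i, w i ^ 2) / 2) := by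
          rw [Finset.sum_const, nsmul_eq_mul, Real.exp_add]
          gcongr
  have h := Real.exp_le_exp.1 (hjensen.trans hbound)
  have h2 : signAvg X ≤ (H + t ^ 2 * (∑ i, w i ^ 2) / 2) / t := by
    rw [le_div_iff₀ ht]
    linarith
  refine h2.trans (le_of_eq ?_)
  field_simp

/-- Optimisation over `t`. Testing `t = x / s` in a proof by contradiction also covers `H = 0`,
where the minimiser `√(2 H / s)` is not positive; `s = 0` needs a separate choice. -/
theorem le_sqrt_of_forall_le_div_add {x H s : ℝ} (hH : 0 ≤ H) (hs : 0 ≤ s)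
    (h : ∀ t : ℝ, 0 < t → x ≤ H / t + t * s / 2) : x ≤ √(2 * H * s) := by
  by_contra! hx
  have hx0 : 0 < x := (Real.sqrt_nonneg _).trans_lt hx
  have hx2 : 2 * H * s < x ^ 2 := (Real.sqrt_lt' hx0).1 hx
  rcases eq_or_lt_of_le hs with hs0 | hs0
  · have := h ((H + 1) / x) (by positivity)
    rw [← hs0, mul_zero, zero_div, add_zero, div_div_eq_mul_div, le_div_iff₀ (by positivity)] at this
    nlinarith
  · have := h (x / s) (by positivity)
    have h2 : H / (x / s) + x / s * s / 2 = H * s / x + x / 2 := by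
      field_simp
    rw [h2] at this
    have h3 : H * s / x < x / 2 := by
      rw [div_lt_iff₀ hx0]
      nlinarith
    linarith

theorem intervalIntegral_indicator_lt {y B : ℝ} (h0 : 0 ≤ y) (hB : y ≤ B) :
    IntervalIntegrable (fun r => if r < y then (1 : ℝ) else 0) volume 0 B ∧
      ∫ r in (0 : ℝ)..B, (if r < y then (1 : ℝ) else 0) = y := by
  have hmeas : Measurable fun r : ℝ => if r < y then (1 : ℝ) else 0 :=
    Measurable.ite measurableSet_Iio measurable_const measurable_const
  have hint : ∀ a b : ℝ, IntervalIntegrable (fun r => if r < y then (1 : ℝ) else 0) volume a b := by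
    intro a b
    refine (intervalIntegrable_const (c := (1 : ℝ))).mono_fun hmeas.aestronglyMeasurable ?_
    refine Filter.Eventually.of_forall fun r => ?_
    dsimp only
    split_ifs <;> simp
  refine ⟨hint 0 B, ?_⟩
  rw [← intervalIntegral.integral_add_adjacent_intervals (hint 0 y) (hint y B)]
  have h1 : ∫ r in (0 : ℝ)..y, (if r < y then (1 : ℝ) else 0) = ∫ r in (0 : ℝ)..y, (1 : ℝ) := by
    refine intervalIntegral.integral_congr_ae ?_
    filter_upwards [compl_mem_ae_iff.2 (measure_singleton y)] with r hr hmem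
    rw [Set.uIoc_of_le h0] at hmem
    rw [if_pos (lt_of_le_of_ne hmem.2 hr)]
  have h2 : ∫ r in y..B, (if r < y then (1 : ℝ) else 0) = ∫ r in y..B, (0 : ℝ) := by
    refine intervalIntegral.integral_congr fun r hmem => ?_
    rw [Set.uIcc_of_le hB] at hmem
    rw [if_neg (not_lt.2 hmem.1)]
  rw [h1, h2]
  simp

/-- Layer cake: `y` is the integral over `r` in `[0, B]` of the indicator of `r < y`. The sign
average commutes with this integral, so the finite-class bound is applied level by level. -/
theorem signAvg_le_of_levels {H B : ℝ} (hH : 0 ≤ H) (hB : 0 ≤ B)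
    {y : (ι → Bool) → ι → ℝ} (hy0 : ∀ σ i, 0 ≤ y σ i) (hyB : ∀ σ i, y σ i ≤ B)
    (hcard : ∀ r : ℝ, ((Finset.univ.image fun σ : ι → Bool =>
      Finset.univ.filter fun i => r < y σ i).card : ℝ) ≤ Real.exp H) (w : ι → ℝ) :
    signAvg (fun σ => ∑ i, sgn (σ i) * (w i * y σ i)) ≤ B * √(2 * H * ∑ i, w i ^ 2) := by
  have hs : 0 ≤ ∑ i, w i ^ 2 := Finset.sum_nonneg fun i _ => sq_nonneg _
  have hlevel : ∀ r : ℝ, signAvg (fun σ => ∑ i, sgn (σ i) * (w i * if r < y σ i then 1 else 0))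
      ≤ √(2 * H * ∑ i, w i ^ 2) := by
    intro r
    refine le_sqrt_of_forall_le_div_add hH hs fun t ht => ?_
    refine le_trans (le_of_eq ?_) (signAvg_le_of_card_le (hcard r)
      (g := fun σ => Finset.univ.filter fun i => r < y σ i)
      (fun σ => Finset.mem_image_of_mem _ (Finset.mem_univ σ)) w ht)
    simp only [mul_ite, mul_one, mul_zero, Finset.sum_filter]
  have hint : ∀ σ i, IntervalIntegrable (fun r => sgn (σ i) * (w i * if r < y σ i then 1 else 0))
      volume 0 B := fun σ i =>
    ((intervalIntegral_indicator_lt (hy0 σ i) (hyB σ i)).1.const_mul (w i)).const_mul _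
  have hint' : IntervalIntegrable (fun r => signAvg fun σ =>
      ∑ i, sgn (σ i) * (w i * if r < y σ i then 1 else 0)) volume 0 B := by
    unfold signAvg
    refine IntervalIntegrable.const_mul ?_ _
    have := IntervalIntegrable.sum Finset.univ fun σ (_ : σ ∈ Finset.univ) =>
      IntervalIntegrable.sum Finset.univ fun i (_ : i ∈ Finset.univ) => hint σ i
    simpa only [Finset.sum_fn] using this
  have heq : signAvg (fun σ => ∑ i, sgn (σ i) * (w i * y σ i))
      = ∫ r in (0 : ℝ)..B, signAvg fun σ =>
          ∑ i, sgn (σ i) * (w i * if r < y σ i then 1 else 0) := by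
    unfold signAvg
    rw [intervalIntegral.integral_const_mul, intervalIntegral.integral_finsetSum]
    · congr 1
      refine Finset.sum_congr rfl fun σ _ => ?_
      rw [intervalIntegral.integral_finsetSum fun i _ => hint σ i]
      refine Finset.sum_congr rfl fun i _ => ?_
      rw [intervalIntegral.integral_const_mul, intervalIntegral.integral_const_mul,
        (intervalIntegral_indicator_lt (hy0 σ i) (hyB σ i)).2]
    · intro σ _
      have := IntervalIntegrable.sum Finset.univ fun i (_ : i ∈ Finset.univ) => hint σ i
      simpa only [Finset.sum_fn] using this
  rw [heq]
  calc _ ≤ ∫ r in (0 : ℝ)..B, √(2 * H * ∑ i, w i ^ 2) :=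
        intervalIntegral.integral_mono_on hB hint' intervalIntegrable_const fun r _ => hlevel r
    _ = _ := by simp

theorem entropy_nonneg {n v : ℕ} (hvn : v ≤ n) : 0 ≤ (v : ℝ) * (1 + Real.log (n / v)) := by
  rcases Nat.eq_zero_or_pos v with rfl | hv
  · simp
  have h : (1 : ℝ) ≤ n / v := by
    rw [one_le_div (by exact_mod_cast hv)]
    exact_mod_cast hvn
  have := Real.log_nonneg h
  positivity

/-- The patterns at level `r` are traces of subgraphs on the points `(z i, r)`, so Sauer–Shelah
gives the same count at every level. -/
theorem signAvg_loss_le {d : ℕ} {Z : Type*} {ℓ : Par d → Z → ℝ} {Θ : Set (Par d)} {v : ℕ}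
    (hv : hypVCDim ℓ Θ ≤ v) (hvn : v ≤ Fintype.card ι) {B : ℝ} (hB0 : 0 ≤ B)
    (hnonneg : ∀ θ z, 0 ≤ ℓ θ z) (hB : ∀ θ ∈ Θ, ∀ z, ℓ θ z ≤ B) (w : ι → ℝ) (z : ι → Z)
    {τ : (ι → Bool) → Par d} (hτ : ∀ σ, τ σ ∈ Θ) :
    signAvg (fun σ => ∑ i, sgn (σ i) * (w i * ℓ (τ σ) (z i)))
      ≤ B * √(2 * (v * (1 + Real.log (Fintype.card ι / v))) * ∑ i, w i ^ 2) := by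
  refine signAvg_le_of_levels (entropy_nonneg hvn) hB0 (fun σ i => hnonneg _ _)
    (fun σ i => hB _ (hτ σ) _) (fun r => ?_) w
  refine card_traces_le_exp hv hvn (fun i => (z i, r)) fun a ha => ?_
  obtain ⟨σ, -, rfl⟩ := Finset.mem_image.1 ha
  exact ⟨_, ⟨τ σ, hτ σ, rfl⟩, fun i => by simp⟩

end Rademacher

/-! ### Suprema over a compact parameter set -/

section Supremum

variable {d : ℕ} {Θ : Set (Par d)} {f : Par d → ℝ}

theorem bddAbove_range_of_isCompact (hΘ : IsCompact Θ) (hf : Continuous f) :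
    BddAbove (Set.range fun θ : Θ => f θ) := by
  rw [← Set.image_eq_range]
  exact hΘ.bddAbove_image hf.continuousOn

theorem le_iSup_of_isCompact (hΘ : IsCompact Θ) (hf : Continuous f) {θ : Par d} (hθ : θ ∈ Θ) :
    f θ ≤ ⨆ θ : Θ, f θ :=
  le_ciSup (bddAbove_range_of_isCompact hΘ hf) (⟨θ, hθ⟩ : Θ)

/-- By continuity in the parameter, the supremum may be taken over a dense sequence of `Θ`. -/
theorem measurable_iSup_of_isCompact {Ω : Type*} [MeasurableSpace Ω] (hΘ : IsCompact Θ)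
    (hne : Θ.Nonempty) {f : Par d → Ω → ℝ} (hcont : ∀ ω, Continuous fun θ => f θ ω)
    (hmeas : ∀ θ, Measurable (f θ)) : Measurable fun ω => ⨆ θ : Θ, f θ ω := by
  have : Nonempty Θ := hne.to_subtype
  have h : ∀ ω, ⨆ θ : Θ, f θ ω = ⨆ n, f (TopologicalSpace.denseSeq Θ n) ω := by
    intro ω
    have hb := bddAbove_range_of_isCompact hΘ (hcont ω)
    have hb' : BddAbove (Set.range fun n => f (TopologicalSpace.denseSeq Θ n) ω) :=
      hb.mono (by rintro _ ⟨n, rfl⟩; exact ⟨_, rfl⟩)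
    refine le_antisymm (ciSup_le fun θ => ?_) (ciSup_le fun n => le_ciSup hb _)
    have hcl : IsClosed {θ : Θ | f θ ω ≤ ⨆ n, f (TopologicalSpace.denseSeq Θ n) ω} :=
      isClosed_le ((hcont ω).comp continuous_subtype_val) continuous_const
    have hsub : Set.range (TopologicalSpace.denseSeq Θ)
        ⊆ {θ : Θ | f θ ω ≤ ⨆ n, f (TopologicalSpace.denseSeq Θ n) ω} := by
      rintro _ ⟨n, rfl⟩
      exact le_ciSup hb' n
    exact closure_minimal hsub hcl (TopologicalSpace.denseRange_denseSeq Θ θ)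
  simp only [h]
  exact Measurable.iSup fun n => hmeas _

end Supremum

theorem integrable_of_measurable_of_abs_le {Ω : Type*} [MeasurableSpace Ω] {μ : Measure Ω}
    [IsFiniteMeasure μ] {f : Ω → ℝ} (hf : Measurable f) {C : ℝ} (hC : ∀ ω, |f ω| ≤ C) :
    Integrable f μ :=
  Integrable.of_bound hf.aestronglyMeasurable C (Filter.Eventually.of_forall hC)

/-- The variance is nonnegative. -/
theorem integral_le_sqrt_integral_sq {Ω : Type*} [MeasurableSpace Ω] {μ : Measure Ω}
    [IsProbabilityMeasure μ] {f : Ω → ℝ} (hf : Integrable f μ)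
    (hf2 : Integrable (fun ω => f ω ^ 2) μ) : ∫ ω, f ω ∂μ ≤ √(∫ ω, f ω ^ 2 ∂μ) := by
  refine Real.le_sqrt_of_sq_le ?_
  set c := ∫ ω, f ω ∂μ
  have h : 0 ≤ ∫ ω, (f ω - c) ^ 2 ∂μ := integral_nonneg fun ω => sq_nonneg _
  have h2 : ∫ ω, (f ω - c) ^ 2 ∂μ = ∫ ω, f ω ^ 2 ∂μ - 2 * c * c + c ^ 2 := by
    have : (fun ω => (f ω - c) ^ 2) = fun ω => f ω ^ 2 - 2 * c * f ω + c ^ 2 := by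
      ext ω; ring
    have hs : Integrable (fun ω => f ω ^ 2 - 2 * c * f ω) μ := hf2.sub (hf.const_mul _)
    rw [this, integral_add hs (integrable_const _),
      integral_sub hf2 (hf.const_mul _), integral_const_mul]
    simp only [integral_const, probReal_univ, one_smul, c]
  nlinarith

/-! ### Loss functions and their risks -/

/-- The assumptions on the parameter set and the loss function. -/
structure IsLoss {d : ℕ} {Z : Type*} [MeasurableSpace Z] (ℓ : Par d → Z → ℝ) (Θ : Set (Par d))
    (B : ℝ) (L : NNReal) : Prop where
  nonempty : Θ.Nonempty
  convex : Convex ℝ Θ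
  closed : IsClosed Θ
  bounded : Bornology.IsBounded Θ
  meas : ∀ θ, Measurable (ℓ θ)
  nonneg : ∀ θ z, 0 ≤ ℓ θ z
  le : ∀ θ ∈ Θ, ∀ z, ℓ θ z ≤ B
  convexOn : ∀ z, ConvexOn ℝ Set.univ fun θ => ℓ θ z
  smooth : ∀ z, IsSmooth L fun θ => ℓ θ z

namespace IsLoss

variable {d : ℕ} {Z : Type*} [MeasurableSpace Z] {ℓ : Par d → Z → ℝ} {Θ : Set (Par d)}
  {B : ℝ} {L : NNReal} (h : IsLoss ℓ Θ B L)

include h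

theorem isCompact : IsCompact Θ := Metric.isCompact_of_isClosed_isBounded h.closed h.bounded

theorem bound_nonneg [Nonempty Z] : 0 ≤ B := by
  obtain ⟨θ, hθ⟩ := h.nonempty
  obtain ⟨z⟩ := ‹Nonempty Z›
  exact (h.nonneg θ z).trans (h.le θ hθ z)

theorem dist_le_diam {x y : Par d} (hx : x ∈ Θ) (hy : y ∈ Θ) : ‖x - y‖ ≤ Metric.diam Θ := by
  rw [← dist_eq_norm]
  exact Metric.dist_le_diam_of_mem h.bounded hx hy

theorem norm_gradient_le {θ : Par d} (hθ : θ ∈ Θ) (z : Z) :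
    ‖gradient (fun x => ℓ x z) θ‖ ≤ gradBound L B :=
  (h.smooth z).norm_gradient_le (fun x => h.nonneg x z) (h.le θ hθ z)

/-- Uniformity in `z` comes from a base point in `Θ` and the common Lipschitz constant. This is the
domination for differentiating the risk under the integral. -/
theorem exists_gradient_bound (x : Par d) :
    ∃ C, ∀ y ∈ Metric.ball x 1, ∀ z, ‖gradient (fun x => ℓ x z) y‖ ≤ C := by
  obtain ⟨θ, hθ⟩ := h.nonempty
  refine ⟨gradBound L B + L * (1 + dist x θ), fun y hy z => ?_⟩
  have h1 := (h.smooth z).2.dist_le_mul y θ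
  have h2 := h.norm_gradient_le hθ z
  have h3 : dist y θ ≤ 1 + dist x θ :=
    (dist_triangle y x θ).trans (by gcongr; exact (Metric.mem_ball.1 hy).le)
  have h4 := norm_le_insert' (gradient (fun x => ℓ x z) y) (gradient (fun x => ℓ x z) θ)
  rw [← dist_eq_norm] at h4
  have h5 := mul_le_mul_of_nonneg_left h3 L.coe_nonneg
  linarith

/-- The bound `B` holds only on `Θ`; quadratic growth from a point of `Θ` carries it elsewhere, so
the risk is a genuine integral on the whole space. -/
theorem exists_bound (x : Par d) : ∃ C, ∀ z, |ℓ x z| ≤ C := by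
  obtain ⟨θ, hθ⟩ := h.nonempty
  refine ⟨B + gradBound L B * ‖x - θ‖ + L / 2 * ‖x - θ‖ ^ 2, fun z => ?_⟩
  rw [abs_of_nonneg (h.nonneg x z)]
  have h1 := (h.smooth z).le_quadratic θ (x - θ)
  rw [add_sub_cancel] at h1
  have h2 := real_inner_le_norm (gradient (fun x => ℓ x z) θ) (x - θ)
  have h3 := mul_le_mul_of_nonneg_right (h.norm_gradient_le hθ z) (norm_nonneg (x - θ))
  have h4 := h.le θ hθ z
  linarith

theorem continuous (z : Z) : Continuous fun θ => ℓ θ z := (h.smooth z).1.continuous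

theorem continuous_gradient (z : Z) : Continuous (gradient fun θ => ℓ θ z) :=
  (h.smooth z).2.continuous

theorem measurable_comp {Ω : Type*} [MeasurableSpace Ω] {τ : Ω → Par d} {ζ : Ω → Z}
    (hτ : Measurable τ) (hζ : Measurable ζ) : Measurable fun ω => ℓ (τ ω) (ζ ω) :=
  (measurable_uncurry_of_continuous_of_measurable h.continuous h.meas).comp (hτ.prodMk hζ)

/-- Each coordinate is a limit of difference quotients with increments `1 / (n + 1)`, which are
measurable in `z`. -/
theorem measurable_gradient (θ : Par d) : Measurable fun z => gradient (fun x => ℓ x z) θ := by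
  have hcoord : ∀ v : Par d, Measurable fun z => inner ℝ (gradient (fun x => ℓ x z) θ) v := by
    intro v
    refine measurable_of_tendsto_metrizable
      (f := fun (n : ℕ) z => ((n : ℝ) + 1) * (ℓ (θ + ((n : ℝ) + 1)⁻¹ • v) z - ℓ θ z))
      (fun n => ((h.meas _).sub (h.meas _)).const_mul _) ?_
    rw [tendsto_pi_nhds]
    intro z
    have hd := hasDerivAt_comp_line (h.smooth z).1 θ v 0
    rw [zero_smul, add_zero, hasDerivAt_iff_tendsto_slope] at hd
    have hseq : Filter.Tendsto (fun n : ℕ => ((n : ℝ) + 1)⁻¹) Filter.atTop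
        (nhdsWithin 0 {0}ᶜ) := by
      refine tendsto_nhdsWithin_iff.2 ⟨?_, Filter.Eventually.of_forall fun n => ?_⟩
      · simpa [one_div] using tendsto_one_div_add_atTop_nhds_zero_nat (𝕜 := ℝ)
      · have : ((n : ℝ) + 1)⁻¹ ≠ 0 := by positivity
        simpa using this
    refine (hd.comp hseq).congr fun n => ?_
    simp [slope_def_field, div_inv_eq_mul, mul_comm]
  have : (fun z => gradient (fun x => ℓ x z) θ) = fun z => WithLp.toLp 2 fun i =>
      inner ℝ (gradient (fun x => ℓ x z) θ) (EuclideanSpace.single i (1 : ℝ)) := by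
    ext z i
    simp only [EuclideanSpace.inner_single_right]
    simp
  rw [this]
  exact (PiLp.continuous_toLp 2 _).measurable.comp (measurable_pi_lambda _ fun i => hcoord _)

theorem measurable_gradient_comp {Ω : Type*} [MeasurableSpace Ω] {τ : Ω → Par d} {ζ : Ω → Z}
    (hτ : Measurable τ) (hζ : Measurable ζ) :
    Measurable fun ω => gradient (fun x => ℓ x (ζ ω)) (τ ω) :=
  (measurable_uncurry_of_continuous_of_measurable h.continuous_gradient
    h.measurable_gradient).comp (hτ.prodMk hζ)

theorem risk_nonneg (P : Measure Z) (θ : Par d) : 0 ≤ risk ℓ P θ :=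
  integral_nonneg (h.nonneg θ)

section Risk

variable (P : Measure Z) [IsProbabilityMeasure P]

theorem integrable (θ : Par d) : Integrable (ℓ θ) P := by
  obtain ⟨C, hC⟩ := h.exists_bound θ
  exact integrable_of_measurable_of_abs_le (h.meas θ) hC

theorem integrable_gradient (θ : Par d) : Integrable (fun z => gradient (fun x => ℓ x z) θ) P := by
  obtain ⟨C, hC⟩ := h.exists_gradient_bound θ
  exact Integrable.of_bound (h.measurable_gradient θ).aestronglyMeasurable C
    (Filter.Eventually.of_forall (hC θ (Metric.mem_ball_self one_pos)))

theorem hasGradientAt_risk (θ : Par d) :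
    HasGradientAt (risk ℓ P) (∫ z, gradient (fun x => ℓ x z) θ ∂P) θ := by
  obtain ⟨C, hC⟩ := h.exists_gradient_bound θ
  have key := hasFDerivAt_integral_of_dominated_of_fderiv_le (μ := P) (𝕜 := ℝ) (F := ℓ) (x₀ := θ)
    (F' := fun y z => InnerProductSpace.toDual ℝ (Par d) (gradient (fun x => ℓ x z) y))
    (bound := fun _ => C) (Metric.ball_mem_nhds θ one_pos)
    (Filter.Eventually.of_forall fun y => (h.meas y).aestronglyMeasurable) (h.integrable P θ)
    ((InnerProductSpace.toDual ℝ (Par d)).continuous.comp_aestronglyMeasurable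
      (h.measurable_gradient θ).aestronglyMeasurable)
    (Filter.Eventually.of_forall fun z y hy => by
      rw [LinearIsometryEquiv.norm_map]; exact hC y hy z)
    (integrable_const C)
    (Filter.Eventually.of_forall fun z y _ => ((h.smooth z).1 y).hasGradientAt.hasFDerivAt)
  rw [hasGradientAt_iff_hasFDerivAt]
  -- The duality isometry commutes with the integral, which turns the Fréchet derivative into a
  -- gradient.
  have hcomm := (InnerProductSpace.toDual ℝ (Par d)).toContinuousLinearEquiv.toContinuousLinearMap
    |>.integral_comp_comm (h.integrable_gradient P θ)
  exact key.congr_fderiv hcomm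

theorem isSmooth_risk : IsSmooth L (risk ℓ P) := by
  refine ⟨fun x => (h.hasGradientAt_risk P x).differentiableAt,
    LipschitzWith.of_dist_le_mul fun x y => ?_⟩
  rw [(h.hasGradientAt_risk P x).gradient, (h.hasGradientAt_risk P y).gradient, dist_eq_norm,
    ← integral_sub (h.integrable_gradient P x) (h.integrable_gradient P y)]
  have := norm_integral_le_of_norm_le_const (μ := P) (Filter.Eventually.of_forall fun z => by
    simpa only [dist_eq_norm] using (h.smooth z).2.dist_le_mul x y)
  simpa [dist_eq_norm] using this

theorem risk_le {θ : Par d} (hθ : θ ∈ Θ) : risk ℓ P θ ≤ B := by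
  have := integral_mono (h.integrable P θ) (integrable_const B) (h.le θ hθ)
  simpa [risk] using this

theorem continuous_risk : Continuous (risk ℓ P) := (h.isSmooth_risk P).1.continuous

end Risk

end IsLoss

/-! ### Uniform deviations by symmetrization -/

section Symmetrization

variable {d : ℕ} {Z : Type*} {ℓ : Par d → Z → ℝ} {Θ : Set (Par d)} {ι : Type*} [Fintype ι]

/-- The largest weighted difference between the losses on the two halves of a sample of pairs. -/
def pairGap (ℓ : Par d → Z → ℝ) (Θ : Set (Par d)) (w : ι → ℝ) (q : ι → Z × Z) : ℝ :=
  ⨆ θ : Θ, ∑ i, w i * (ℓ θ (q i).2 - ℓ θ (q i).1)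

/-- Exchange the members of the pairs for which the sign is negative. -/
def signSwap (b : Bool) : Z × Z → Z × Z := if b then id else Prod.swap

theorem pairGap_signSwap (w : ι → ℝ) (σ : ι → Bool) (q : ι → Z × Z) :
    pairGap ℓ Θ w (fun i => signSwap (σ i) (q i))
      = ⨆ θ : Θ, ∑ i, sgn (σ i) * w i * (ℓ θ (q i).2 - ℓ θ (q i).1) := by
  unfold pairGap
  congr 1
  ext θ
  refine Finset.sum_congr rfl fun i _ => ?_
  cases hb : σ i
  · simp only [signSwap, sgn, Bool.false_eq_true, if_false, Prod.fst_swap, Prod.snd_swap, hb]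
    ring
  · simp only [signSwap, sgn, if_true, id_eq, one_mul, hb]

variable [MeasurableSpace Z] {B : ℝ} {L : NNReal}

theorem IsLoss.continuous_pairSum (h : IsLoss ℓ Θ B L) (w : ι → ℝ) (q : ι → Z × Z) :
    Continuous fun θ => ∑ i, w i * (ℓ θ (q i).2 - ℓ θ (q i).1) :=
  continuous_finsetSum _ fun _ _ =>
    continuous_const.mul ((h.continuous _).sub (h.continuous _))

theorem IsLoss.abs_pairSum_le (h : IsLoss ℓ Θ B L) (w : ι → ℝ) (q : ι → Z × Z) {θ : Par d}
    (hθ : θ ∈ Θ) : |∑ i, w i * (ℓ θ (q i).2 - ℓ θ (q i).1)| ≤ ∑ i, |w i| * B := by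
  refine (Finset.abs_sum_le_sum_abs _ _).trans (Finset.sum_le_sum fun i _ => ?_)
  rw [abs_mul]
  refine mul_le_mul_of_nonneg_left (abs_le.2 ⟨?_, ?_⟩) (abs_nonneg _)
  · linarith [h.nonneg θ (q i).2, h.le θ hθ (q i).1]
  · linarith [h.nonneg θ (q i).1, h.le θ hθ (q i).2]

theorem IsLoss.measurable_pairGap (h : IsLoss ℓ Θ B L) (w : ι → ℝ) :
    Measurable (pairGap ℓ Θ w) := by
  refine measurable_iSup_of_isCompact h.isCompact h.nonempty (h.continuous_pairSum w) fun θ => ?_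
  refine Finset.measurable_sum _ fun i _ => Measurable.const_mul ?_ _
  exact ((h.meas θ).comp (measurable_snd.comp (measurable_pi_apply i))).sub
    ((h.meas θ).comp (measurable_fst.comp (measurable_pi_apply i)))

theorem IsLoss.abs_pairGap_le (h : IsLoss ℓ Θ B L) (w : ι → ℝ) (q : ι → Z × Z) :
    |pairGap ℓ Θ w q| ≤ ∑ i, |w i| * B := by
  have : Nonempty Θ := h.nonempty.to_subtype
  obtain ⟨θ, hθ⟩ := h.nonempty
  refine abs_le.2 ⟨?_, ciSup_le fun θ => (abs_le.1 (h.abs_pairSum_le w q θ.2)).2⟩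
  exact (abs_le.1 (h.abs_pairSum_le w q hθ)).1.trans
    (le_iSup_of_isCompact h.isCompact (h.continuous_pairSum w q) hθ)

/-- The two members of a pair are independent with the same law, though this law may change from
pair to pair. -/
theorem measurePreserving_signSwap (P : ι → Measure Z) [∀ i, IsProbabilityMeasure (P i)]
    (σ : ι → Bool) : MeasurePreserving (fun (q : ι → Z × Z) i => signSwap (σ i) (q i))
      (Measure.pi fun i => (P i).prod (P i)) (Measure.pi fun i => (P i).prod (P i)) := by
  refine measurePreserving_pi _ _ fun i => ?_
  cases σ i
  · exact Measure.measurePreserving_swap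
  · exact MeasurePreserving.id _

/-- By compactness the supremum is attained, at a parameter depending on the signs. The two halves
of the sample are then bounded separately, whence the factor 2. -/
theorem IsLoss.signAvg_pairGap_le [DecidableEq ι] [Nonempty Z] (h : IsLoss ℓ Θ B L) {v : ℕ}
    (hv : hypVCDim ℓ Θ ≤ v) (hvn : v ≤ Fintype.card ι) (w : ι → ℝ) (q : ι → Z × Z) :
    signAvg (fun σ => pairGap ℓ Θ w (fun i => signSwap (σ i) (q i)))
      ≤ 2 * (B * √(2 * (v * (1 + Real.log (Fintype.card ι / v))) * ∑ i, w i ^ 2)) := by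
  have : Nonempty Θ := h.nonempty.to_subtype
  have hmax : ∀ σ : ι → Bool, ∃ θ ∈ Θ, ∀ θ' ∈ Θ,
      ∑ i, sgn (σ i) * w i * (ℓ θ' (q i).2 - ℓ θ' (q i).1)
        ≤ ∑ i, sgn (σ i) * w i * (ℓ θ (q i).2 - ℓ θ (q i).1) := fun σ =>
    h.isCompact.exists_isMaxOn h.nonempty (h.continuous_pairSum _ q).continuousOn
  choose τ hτ hτmax using hmax
  have h1 := signAvg_loss_le hv hvn h.bound_nonneg h.nonneg h.le w (fun i => (q i).2) hτ
  have h2 := signAvg_loss_le hv hvn h.bound_nonneg h.nonneg h.le (fun i => -w i)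
    (fun i => (q i).1) hτ
  simp only [neg_sq] at h2
  rw [two_mul (B * _)]
  refine le_trans ?_ (add_le_add h1 h2)
  rw [← signAvg_add]
  refine signAvg_mono fun σ => ?_
  rw [pairGap_signSwap, ← Finset.sum_add_distrib]
  refine ciSup_le fun θ => (hτmax σ θ θ.2).trans (le_of_eq ?_)
  exact Finset.sum_congr rfl fun i _ => by ring

/-- No sign pattern changes the integral, so it equals its average over all patterns. -/
theorem IsLoss.integral_pairGap_le [DecidableEq ι] [Nonempty Z] (h : IsLoss ℓ Θ B L) {v : ℕ}
    (hv : hypVCDim ℓ Θ ≤ v) (hvn : v ≤ Fintype.card ι) (P : ι → Measure Z)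
    [∀ i, IsProbabilityMeasure (P i)] (w : ι → ℝ) :
    ∫ q, pairGap ℓ Θ w q ∂(Measure.pi fun i => (P i).prod (P i))
      ≤ 2 * (B * √(2 * (v * (1 + Real.log (Fintype.card ι / v))) * ∑ i, w i ^ 2)) := by
  set ν := Measure.pi fun i => (P i).prod (P i)
  have hswap : ∀ σ : ι → Bool,
      ∫ q, pairGap ℓ Θ w (fun i => signSwap (σ i) (q i)) ∂ν = ∫ q, pairGap ℓ Θ w q ∂ν := by
    intro σ
    have hmp := measurePreserving_signSwap P σ
    have hmap := integral_map (μ := ν) hmp.measurable.aemeasurable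
      (h.measurable_pairGap w).aestronglyMeasurable
    rw [hmp.map_eq] at hmap
    exact hmap.symm
  have hint : ∀ σ : ι → Bool,
      Integrable (fun q => pairGap ℓ Θ w (fun i => signSwap (σ i) (q i))) ν := fun σ =>
    integrable_of_measurable_of_abs_le
      ((h.measurable_pairGap w).comp (measurePreserving_signSwap P σ).measurable)
      fun q => h.abs_pairGap_le w _
  have havg : ∫ q, pairGap ℓ Θ w q ∂ν
      = ∫ q, signAvg (fun σ => pairGap ℓ Θ w (fun i => signSwap (σ i) (q i))) ∂ν := by
    unfold signAvg
    rw [integral_const_mul, integral_finsetSum _ fun σ _ => hint σ]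
    simp only [hswap]
    exact (signAvg_const _).symm
  rw [havg]
  calc _ ≤ ∫ _, 2 * (B * √(2 * (v * (1 + Real.log (Fintype.card ι / v))) * ∑ i, w i ^ 2)) ∂ν := by
        refine integral_mono ?_ (integrable_const _) fun q => h.signAvg_pairGap_le hv hvn w q
        unfold signAvg
        exact (integrable_finsetSum _ fun σ _ => hint σ).const_mul _
    _ = _ := by simp

/-- The expected generalization gap of a data-dependent parameter. -/
theorem IsLoss.integral_gap_le [DecidableEq ι] [Nonempty Z] (h : IsLoss ℓ Θ B L) {v : ℕ}
    (hv : hypVCDim ℓ Θ ≤ v) (hvn : v ≤ Fintype.card ι) (P : ι → Measure Z)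
    [∀ i, IsProbabilityMeasure (P i)] (w : ι → ℝ) {τ : (ι → Z) → Par d} (hτ : Measurable τ)
    (hτΘ : ∀ S, τ S ∈ Θ) :
    ∫ S, ∑ i, w i * (risk ℓ (P i) (τ S) - ℓ (τ S) (S i)) ∂(Measure.pi P)
      ≤ 2 * (B * √(2 * (v * (1 + Real.log (Fintype.card ι / v))) * ∑ i, w i ^ 2)) := by
  -- Ghost sample: `x.2` is an independent copy of the data `x.1`, and averaging over it produces
  -- the risks at `τ x.1`.
  set ψ : (ι → Z) × (ι → Z) → ℝ := fun x => ∑ i, w i * (ℓ (τ x.1) (x.2 i) - ℓ (τ x.1) (x.1 i))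
  have hψm : Measurable ψ := by
    refine Finset.measurable_sum _ fun i _ => Measurable.const_mul ?_ _
    exact (h.measurable_comp (hτ.comp measurable_fst)
      ((measurable_pi_apply i).comp measurable_snd)).sub
      (h.measurable_comp (hτ.comp measurable_fst) ((measurable_pi_apply i).comp measurable_fst))
  have hψint : Integrable ψ ((Measure.pi P).prod (Measure.pi P)) :=
    integrable_of_measurable_of_abs_le hψm fun x =>
      h.abs_pairSum_le w (fun i => (x.1 i, x.2 i)) (hτΘ x.1)
  have hinner : ∀ S, ∑ i, w i * (risk ℓ (P i) (τ S) - ℓ (τ S) (S i))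
      = ∫ S', ψ (S, S') ∂(Measure.pi P) := by
    intro S
    have hi : ∀ i, Integrable (fun S' : ι → Z => ℓ (τ S) (S' i)) (Measure.pi P) := fun i =>
      integrable_of_measurable_of_abs_le ((h.meas _).comp (measurable_pi_apply i))
        fun S' => (h.exists_bound (τ S)).choose_spec (S' i)
    have hi' : ∀ i, Integrable (fun S' : ι → Z => w i * (ℓ (τ S) (S' i) - ℓ (τ S) (S i)))
        (Measure.pi P) := fun i => ((hi i).sub (integrable_const _)).const_mul _
    simp only [ψ]
    rw [integral_finsetSum _ fun i _ => hi' i]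
    refine Finset.sum_congr rfl fun i _ => ?_
    rw [integral_const_mul, integral_sub (hi i) (integrable_const _),
      integral_comp_eval (μ := P) (h.meas (τ S)).aestronglyMeasurable]
    simp [risk]
  have hmp := measurePreserving_arrowProdEquivProdArrow Z Z ι P P
  have hle : ∫ x, ψ x ∂((Measure.pi P).prod (Measure.pi P))
      ≤ ∫ q, pairGap ℓ Θ w q ∂(Measure.pi fun i => (P i).prod (P i)) := by
    -- A pair of samples is read as a sample of pairs, where the parameter `τ` is dominated by the
    -- supremum over `Θ`.
    rw [← hmp.integral_comp']
    refine integral_mono (hmp.integrable_comp_of_integrable hψint)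
      (integrable_of_measurable_of_abs_le (h.measurable_pairGap w) (h.abs_pairGap_le w))
      fun q => ?_
    exact le_iSup_of_isCompact h.isCompact (h.continuous_pairSum w q) (hτΘ _)
  simp only [hinner]
  rw [← integral_prod _ hψint]
  exact hle.trans (h.integral_pairGap_le hv hvn P w)

end Symmetrization

/-! ### One round of projected federated averaging -/

section Round

variable {d : ℕ}

/-- `k` gradient steps of size `η` on `f`, started at `x`. -/
def gradIter (f : Par d → ℝ) (η : ℝ) (k : ℕ) (x : Par d) : Par d :=
  (fun y => y - η • gradient f y)^[k] x

theorem gradIter_zero (f : Par d → ℝ) (η : ℝ) (x : Par d) : gradIter f η 0 x = x := rfl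

theorem gradIter_succ (f : Par d → ℝ) (η : ℝ) (k : ℕ) (x : Par d) :
    gradIter f η (k + 1) x = gradIter f η k x - η • gradient f (gradIter f η k x) :=
  Function.iterate_succ_apply' _ _ _

theorem gradIter_sub (f : Par d → ℝ) (η : ℝ) (k : ℕ) (x : Par d) :
    gradIter f η k x - x = -∑ j ∈ Finset.range k, η • gradient f (gradIter f η j x) := by
  induction k with
  | zero => simp [gradIter_zero]
  | succ k ih =>
    rw [gradIter_succ, Finset.sum_range_succ, neg_add, ← ih]
    abel

/-- Local iterates are not projected and may leave `Θ`; descent keeps their values, and thereby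
their gradients, bounded. -/
theorem IsSmooth.gradIter_le {L : NNReal} {f : Par d → ℝ} (hf : IsSmooth L f) {η : ℝ} (hη : 0 ≤ η)
    (hηL : η * L ≤ 2) (x : Par d) (k : ℕ) : f (gradIter f η k x) ≤ f x := by
  induction k with
  | zero => exact le_rfl
  | succ k ih =>
    rw [gradIter_succ]
    refine (hf.gradient_step _ η).trans (le_trans ?_ ih)
    have : 0 ≤ η * (1 - L * η / 2) * ‖gradient f (gradIter f η k x)‖ ^ 2 := by
      have : 0 ≤ 1 - L * η / 2 := by linarith
      positivity
    linarith

variable {L : NNReal} {f : Par d → ℝ} {B η : ℝ} {E : ℕ} {x : Par d}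

theorem IsSmooth.norm_gradIter_sub_le (hf : IsSmooth L f) (hnonneg : ∀ y, 0 ≤ f y) (hη : 0 ≤ η)
    (hB : ∀ k < E, f (gradIter f η k x) ≤ B) {k : ℕ} (hk : k ≤ E) :
    ‖gradIter f η k x - x‖ ≤ η * k * gradBound L B := by
  rw [gradIter_sub, norm_neg]
  calc ‖∑ j ∈ Finset.range k, η • gradient f (gradIter f η j x)‖
      ≤ ∑ j ∈ Finset.range k, η * gradBound L B := by
        refine norm_sum_le_of_le _ fun j hj => ?_
        rw [norm_smul, Real.norm_of_nonneg hη]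
        exact mul_le_mul_of_nonneg_left
          (hf.norm_gradient_le hnonneg (hB j ((Finset.mem_range.1 hj).trans_le hk))) hη
    _ = η * k * gradBound L B := by
        rw [Finset.sum_const, Finset.card_range, nsmul_eq_mul]
        ring

/-- Compares `E` local steps with one step of length `η E`. Every gradient is evaluated within `η (E
- 1) G` of `x`; this `E - 1` produces the factor `1 - 1 / E`. -/
theorem IsSmooth.norm_gradIter_sub_add_le (hf : IsSmooth L f) (hnonneg : ∀ y, 0 ≤ f y)
    (hη : 0 ≤ η) (hE : 0 < E) (hB : ∀ k < E, f (gradIter f η k x) ≤ B) :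
    ‖gradIter f η E x - x + (η * E) • gradient f x‖
      ≤ (η * E) ^ 2 * (L * gradBound L B * (1 - (E : ℝ)⁻¹)) := by
  have hE' : (1 : ℝ) ≤ E := by exact_mod_cast hE
  have heq : gradIter f η E x - x + (η * E) • gradient f x
      = -∑ j ∈ Finset.range E, η • (gradient f (gradIter f η j x) - gradient f x) := by
    rw [gradIter_sub]
    simp only [smul_sub, Finset.sum_sub_distrib, Finset.sum_const, Finset.card_range]
    rw [neg_sub, mul_comm η, mul_smul, Nat.cast_smul_eq_nsmul]
    abel
  rw [heq, norm_neg]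
  calc ‖∑ j ∈ Finset.range E, η • (gradient f (gradIter f η j x) - gradient f x)‖
      ≤ ∑ j ∈ Finset.range E, η * (L * (η * (E - 1) * gradBound L B)) := by
        refine norm_sum_le_of_le _ fun j hj => ?_
        have hj' := Finset.mem_range.1 hj
        rw [norm_smul, Real.norm_of_nonneg hη]
        refine mul_le_mul_of_nonneg_left ?_ hη
        have h1 := hf.2.dist_le_mul (gradIter f η j x) x
        rw [dist_eq_norm, dist_eq_norm] at h1
        refine h1.trans (mul_le_mul_of_nonneg_left ?_ L.coe_nonneg)
        refine (hf.norm_gradIter_sub_le hnonneg hη hB hj'.le).trans ?_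
        have h2 : (j : ℝ) ≤ E - 1 := by
          have : (j : ℝ) + 1 ≤ E := by exact_mod_cast hj'
          linarith
        exact mul_le_mul_of_nonneg_right (mul_le_mul_of_nonneg_left h2 hη) (gradBound_nonneg L B)
    _ = (η * E) ^ 2 * (L * gradBound L B * (1 - (E : ℝ)⁻¹)) := by
        rw [Finset.sum_const, Finset.card_range, nsmul_eq_mul]
        field_simp

theorem norm_sum_smul_le {ι V : Type*} [Fintype ι] [SeminormedAddCommGroup V] [NormedSpace ℝ V]
    {p : ι → ℝ} (hp : p ∈ stdSimplex ℝ ι) {v : ι → V} {C : ℝ} (hv : ∀ i, ‖v i‖ ≤ C) :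
    ‖∑ i, p i • v i‖ ≤ C := by
  refine (norm_sum_le_of_le (f := fun i => p i • v i) (n := fun i => p i * C) _
    fun i _ => ?_).trans (le_of_eq ?_)
  · rw [norm_smul, Real.norm_of_nonneg (hp.1 i)]
    exact mul_le_mul_of_nonneg_left (hv i) (hp.1 i)
  · rw [← Finset.sum_mul, hp.2, one_mul]

/-- The progress of one round towards any point `u` of the parameter set. -/
theorem round_progress {Θ : Set (Par d)} (hconv : Convex ℝ Θ) (hclosed : IsClosed Θ)
    (hbdd : Bornology.IsBounded Θ) {ι : Type*} [Fintype ι] {p : ι → ℝ} (hp : p ∈ stdSimplex ℝ ι)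
    {φ : ι → Par d → ℝ} (hφ : ∀ i, IsSmooth L (φ i)) (hcvx : ∀ i, ConvexOn ℝ Set.univ (φ i))
    (hnonneg : ∀ i y, 0 ≤ φ i y) (hη : 0 ≤ η) (hE : 0 < E)
    (hB : ∀ i, ∀ k < E, φ i (gradIter (φ i) η k x) ≤ B) (hx : x ∈ Θ) {u : Par d} (hu : u ∈ Θ) :
    2 * (η * E) * (∑ i, p i * φ i x - ∑ i, p i * φ i u)
      ≤ ‖x - u‖ ^ 2 - ‖proj Θ (x + ∑ i, p i • (gradIter (φ i) η E x - x)) - u‖ ^ 2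
        + (η * E) ^ 2 * (gradBound L B ^ 2
          + 2 * (L * Metric.diam Θ * gradBound L B * (1 - (E : ℝ)⁻¹))) := by
  set G := gradBound L B
  set D := Metric.diam Θ
  set δ : Par d := ∑ i, p i • (gradIter (φ i) η E x - x)
  set g : Par d := ∑ i, p i • gradient (φ i) x
  have hE1 : (1 : ℝ) ≤ E := by exact_mod_cast hE
  have hδ : ‖δ‖ ≤ η * E * G := norm_sum_smul_le hp fun i =>
    (hφ i).norm_gradIter_sub_le (hnonneg i) hη (hB i) le_rfl
  have hδg : ‖δ + (η * E) • g‖ ≤ (η * E) ^ 2 * (L * G * (1 - (E : ℝ)⁻¹)) := by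
    have : δ + (η * E) • g
        = ∑ i, p i • (gradIter (φ i) η E x - x + (η * E) • gradient (φ i) x) := by
      simp only [δ, g, smul_add, Finset.sum_add_distrib, Finset.smul_sum]
      congr 1
      exact Finset.sum_congr rfl fun i _ => smul_comm _ _ _
    rw [this]
    exact norm_sum_smul_le hp fun i =>
      (hφ i).norm_gradIter_sub_add_le (hnonneg i) hη hE (hB i)
  have hD : ‖x - u‖ ≤ D := by
    rw [← dist_eq_norm]
    exact Metric.dist_le_diam_of_mem hbdd hx hu
  have hgrad : ∑ i, p i * φ i x - ∑ i, p i * φ i u ≤ inner ℝ g (x - u) := by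
    rw [← Finset.sum_sub_distrib, sum_inner]
    refine Finset.sum_le_sum fun i _ => ?_
    rw [← mul_sub, real_inner_smul_left]
    exact mul_le_mul_of_nonneg_left (sub_le_inner_gradient (hφ i).1 (hcvx i) x u) (hp.1 i)
  have hproj := norm_proj_sub_sq_le hconv hclosed ⟨x, hx⟩ (x + δ) hu
  have hexp : ‖x + δ - u‖ ^ 2 = ‖x - u‖ ^ 2 + 2 * inner ℝ (x - u) δ + ‖δ‖ ^ 2 := by
    rw [← norm_add_sq_real]
    congr 2
    abel
  -- The aggregated update is `-(η E) g` up to the second-order drift `hδg`, which is paired with a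
  -- vector of length at most `D`.
  have hinner : inner ℝ (x - u) δ
      ≤ D * ((η * E) ^ 2 * (L * G * (1 - (E : ℝ)⁻¹))) - η * E * inner ℝ g (x - u) := by
    have h1 : inner ℝ (x - u) δ
        = inner ℝ (x - u) (δ + (η * E) • g) - η * E * inner ℝ g (x - u) := by
      rw [inner_add_right, real_inner_smul_right, real_inner_comm g (x - u)]
      ring
    have h2 := (real_inner_le_norm (x - u) (δ + (η * E) • g)).trans
      (mul_le_mul hD hδg (norm_nonneg _) ((norm_nonneg _).trans hD))
    linarith
  have hδ2 : ‖δ‖ ^ 2 ≤ (η * E * G) ^ 2 := by gcongr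
  have hηE : 0 ≤ η * E := by positivity
  have h3 := mul_le_mul_of_nonneg_left hgrad hηE
  nlinarith

end Round

/-! ### The federated algorithm for a fixed dataset -/

namespace Schedule

section Pathwise

variable {d M T : ℕ} {Z : Type*} {W : Schedule M T} {ℓ : Par d → Z → ℝ}
  {Θ : Set (Par d)} {B : ℝ} {L : NNReal}

theorem memWt_nonneg (hwt : ∀ t m j, 0 ≤ W.wt t m j) (t : Fin T) (m : Fin M) :
    0 ≤ W.memWt t m := Finset.sum_nonneg fun j _ => hwt t m j

theorem localRisk_eq (ℓ : Par d → Z → ℝ) (S : W.Dataset Z) (t : Fin T) (m : Fin M) :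
    W.localRisk ℓ S t m
      = fun θ => ∑ j ∈ W.mem t m, W.wt t m j / W.memWt t m * ℓ θ (S ⟨m, j⟩) := by
  ext θ
  rw [localRisk, Finset.sum_div]
  exact Finset.sum_congr rfl fun j _ => by ring

theorem memWt_mul_localRisk (hwt : ∀ t m j, 0 ≤ W.wt t m j) (ℓ : Par d → Z → ℝ)
    (S : W.Dataset Z) (t : Fin T) (m : Fin M) (θ : Par d) :
    W.memWt t m * W.localRisk ℓ S t m θ = ∑ j ∈ W.mem t m, W.wt t m j * ℓ θ (S ⟨m, j⟩) := by
  by_cases h0 : W.memWt t m = 0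
  · rw [h0, zero_mul]
    have := (Finset.sum_eq_zero_iff_of_nonneg fun j _ => hwt t m j).1 h0
    exact (Finset.sum_eq_zero fun j hj => by rw [this j hj, zero_mul]).symm
  · exact mul_div_cancel₀ _ h0

theorem sum_wt_div_le_one (W : Schedule M T) (t : Fin T) (m : Fin M) :
    ∑ j ∈ W.mem t m, W.wt t m j / W.memWt t m ≤ 1 := by
  rw [← Finset.sum_div]
  exact div_self_le_one _

/-- The weighted risk that the clients see in round `t`. -/
def roundRisk (W : Schedule M T) (p : Fin M → ℝ) (ℓ : Par d → Z → ℝ) (S : W.Dataset Z) (t : Fin T)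
    (θ : Par d) : ℝ := ∑ m, p m * W.localRisk ℓ S t m θ

theorem globalRisk_eq (hwt : ∀ t m j, 0 ≤ W.wt t m j) {p : Fin M → ℝ}
    (hp : p ∈ stdSimplex ℝ (Fin M)) (hagg : ∀ t m, W.aggWt t m = p m) (hq : ∀ t, W.roundWt t = (T : ℝ)⁻¹)
    {ℓ : Par d → Z → ℝ} (S : W.Dataset Z) (θ : Par d) :
    W.globalRisk ℓ S θ = ∑ t, (T : ℝ)⁻¹ * W.roundRisk p ℓ S t θ := by
  rw [globalRisk, Finset.sum_comm, Finset.sum_div]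
  refine Finset.sum_congr rfl fun t _ => ?_
  -- With zero total weight all aggregation weights would be `0 / 0 = 0` and could not sum to 1.
  have hne : ∑ m, W.memWt t m ≠ 0 := by
    intro h0
    have : ∑ m, p m = 0 := Finset.sum_eq_zero fun m _ => by rw [← hagg t m, aggWt, h0, div_zero]
    rw [hp.2] at this
    exact one_ne_zero this
  rw [← hq t, roundRisk, Finset.mul_sum, Finset.sum_div]
  refine Finset.sum_congr rfl fun m _ => ?_
  rw [← memWt_mul_localRisk hwt, ← hagg t m, roundWt, aggWt]
  field_simp

theorem uniform_mem_stdSimplex (hT : 0 < T) :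
    (fun _ : Fin T => (T : ℝ)⁻¹) ∈ stdSimplex ℝ (Fin T) := by
  refine ⟨fun _ => by positivity, ?_⟩
  simp only [Finset.sum_const, Finset.card_univ, Fintype.card_fin, nsmul_eq_mul]
  exact mul_inv_cancel₀ (by positivity)

variable [MeasurableSpace Z] (h : IsLoss ℓ Θ B L) (hwt : ∀ t m j, 0 ≤ W.wt t m j)

include h hwt

theorem isSmooth_localRisk (S : W.Dataset Z) (t : Fin T) (m : Fin M) :
    IsSmooth L (W.localRisk ℓ S t m) := by
  rw [localRisk_eq]
  exact IsSmooth.sum_mul (f := fun j θ => ℓ θ (S ⟨m, j⟩)) (fun j _ => h.smooth _)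
    (fun j _ => div_nonneg (hwt t m j) (memWt_nonneg hwt t m)) (W.sum_wt_div_le_one t m)

theorem convexOn_localRisk (S : W.Dataset Z) (t : Fin T) (m : Fin M) :
    ConvexOn ℝ Set.univ (W.localRisk ℓ S t m) := by
  rw [localRisk_eq]
  exact convexOn_sum_mul (f := fun j θ => ℓ θ (S ⟨m, j⟩)) (fun j _ => h.convexOn _)
    (fun j _ => div_nonneg (hwt t m j) (memWt_nonneg hwt t m))

theorem localRisk_nonneg (S : W.Dataset Z) (t : Fin T) (m : Fin M) (θ : Par d) :
    0 ≤ W.localRisk ℓ S t m θ :=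
  div_nonneg (Finset.sum_nonneg fun j _ => mul_nonneg (hwt t m j) (h.nonneg _ _))
    (memWt_nonneg hwt t m)

theorem localRisk_le (hB0 : 0 ≤ B) (S : W.Dataset Z) (t : Fin T) (m : Fin M) {θ : Par d}
    (hθ : θ ∈ Θ) : W.localRisk ℓ S t m θ ≤ B := by
  rw [localRisk_eq]
  calc ∑ j ∈ W.mem t m, W.wt t m j / W.memWt t m * ℓ θ (S ⟨m, j⟩)
      ≤ ∑ j ∈ W.mem t m, W.wt t m j / W.memWt t m * B :=
        Finset.sum_le_sum fun j _ => mul_le_mul_of_nonneg_left (h.le θ hθ _)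
          (div_nonneg (hwt t m j) (memWt_nonneg hwt t m))
    _ ≤ B := by
        rw [← Finset.sum_mul]
        exact mul_le_of_le_one_left hB0 (W.sum_wt_div_le_one t m)

omit hwt in
theorem batchGrad_eq (S : W.Dataset Z) (t : Fin T) (m : Fin M) (x : Par d) :
    W.batchGrad ℓ S t m x = gradient (W.localRisk ℓ S t m) x := by
  rw [localRisk_eq]
  exact (hasGradientAt_sum_mul (W.mem t m) (fun j => W.wt t m j / W.memWt t m)
    (f := fun j θ => ℓ θ (S ⟨m, j⟩)) (fun j _ => (h.smooth _).1) x).gradient.symm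

omit hwt in
theorem localModel_eq (η : ℝ) (E : ℕ) (S : W.Dataset Z) (t : Fin T) (m : Fin M) (x : Par d) :
    W.localModel ℓ η E S t m x = gradIter (W.localRisk ℓ S t m) η E x := by
  simp only [localModel, gradIter, batchGrad_eq h]

omit hwt in
theorem model_mem {η : ℝ} {E : ℕ} {θ₁ : Par d} (hθ₁ : θ₁ ∈ Θ) (S : W.Dataset Z) (k : ℕ) :
    W.model ℓ Θ η E θ₁ S k ∈ Θ := by
  induction k with
  | zero => exact hθ₁
  | succ k ih =>
    rw [model]
    split_ifs
    · exact proj_mem h.closed h.nonempty _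
    · exact ih

omit hwt in
theorem output_mem {η : ℝ} {E : ℕ} {θ₁ : Par d} (hθ₁ : θ₁ ∈ Θ) (hT : 0 < T)
    (hq : ∀ t, W.roundWt t = (T : ℝ)⁻¹) (S : W.Dataset Z) : W.output ℓ Θ η E θ₁ S ∈ Θ := by
  refine h.convex.sum_mem (fun t _ => ?_) ?_ fun t _ => model_mem h hθ₁ S t
  · rw [hq]; positivity
  · simp only [hq, Finset.sum_const, Finset.card_univ, Fintype.card_fin, nsmul_eq_mul]
    exact mul_inv_cancel₀ (by positivity)

variable {p : Fin M → ℝ} (hp : p ∈ stdSimplex ℝ (Fin M))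

include hp

theorem isSmooth_roundRisk (S : W.Dataset Z) (t : Fin T) : IsSmooth L (W.roundRisk p ℓ S t) :=
  IsSmooth.sum_mul (fun m _ => isSmooth_localRisk h hwt S t m) (fun m _ => hp.1 m) hp.2.le

theorem convexOn_roundRisk (S : W.Dataset Z) (t : Fin T) :
    ConvexOn ℝ Set.univ (W.roundRisk p ℓ S t) :=
  convexOn_sum_mul (fun m _ => convexOn_localRisk h hwt S t m) fun m _ => hp.1 m

theorem roundRisk_nonneg (S : W.Dataset Z) (t : Fin T) (θ : Par d) : 0 ≤ W.roundRisk p ℓ S t θ :=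
  Finset.sum_nonneg fun m _ => mul_nonneg (hp.1 m) (localRisk_nonneg h hwt S t m θ)

theorem roundRisk_le (hB0 : 0 ≤ B) (S : W.Dataset Z) (t : Fin T) {θ : Par d} (hθ : θ ∈ Θ) :
    W.roundRisk p ℓ S t θ ≤ B := by
  calc W.roundRisk p ℓ S t θ ≤ ∑ m, p m * B :=
        Finset.sum_le_sum fun m _ => mul_le_mul_of_nonneg_left (localRisk_le h hwt hB0 S t m hθ)
          (hp.1 m)
    _ = B := by rw [← Finset.sum_mul, hp.2, one_mul]

/-- The regret of the federated algorithm against any fixed point. -/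
theorem sum_regret_le (hagg : ∀ t m, W.aggWt t m = p m) (hB0 : 0 ≤ B) {η : ℝ} {E : ℕ}
    {θ₁ u : Par d} (hη : 0 ≤ η) (hE : 0 < E)
    (hstep : E = 1 ∨ η * L ≤ 2) (hθ₁ : θ₁ ∈ Θ) (hu : u ∈ Θ) (S : W.Dataset Z) :
    2 * (η * E) * ∑ t : Fin T, (W.roundRisk p ℓ S t (W.model ℓ Θ η E θ₁ S t)
        - W.roundRisk p ℓ S t u)
      ≤ Metric.diam Θ ^ 2 + T * ((η * E) ^ 2 * (gradBound L B ^ 2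
          + 2 * (L * Metric.diam Θ * gradBound L B * (1 - (E : ℝ)⁻¹)))) := by
  set x := W.model ℓ Θ η E θ₁ S
  set R := (η * E) ^ 2 * (gradBound L B ^ 2
          + 2 * (L * Metric.diam Θ * gradBound L B * (1 - (E : ℝ)⁻¹)))
  have hx : ∀ k, x k ∈ Θ := model_mem h hθ₁ S
  have hstep' : ∀ t : Fin T, 2 * (η * E) * (W.roundRisk p ℓ S t (x t) - W.roundRisk p ℓ S t u)
      ≤ ‖x t - u‖ ^ 2 - ‖x (t + 1) - u‖ ^ 2 + R := by
    intro t
    have hsucc : x (t + 1) = proj Θ (x t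
        + ∑ m, p m • (gradIter (W.localRisk ℓ S t m) η E (x t) - x t)) := by
      simp only [x, model, dif_pos t.2, hagg, localModel_eq h]
    rw [hsucc]
    refine round_progress h.convex h.closed h.bounded hp
      (fun m => isSmooth_localRisk h hwt S t m) (fun m => convexOn_localRisk h hwt S t m)
      (fun m => localRisk_nonneg h hwt S t m) hη hE (fun m k hk => ?_) (hx t) hu
    have hle := localRisk_le h hwt hB0 S t m (hx t)
    -- A single local step evaluates the gradient only at the point of `Θ` where it starts, so no
    -- restriction on the learning rate is needed.
    rcases hstep with rfl | hstep
    · obtain rfl : k = 0 := by omega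
      exact hle
    · exact ((isSmooth_localRisk h hwt S t m).gradIter_le hη hstep _ k).trans hle
  have htel : ∑ t : Fin T, (‖x t - u‖ ^ 2 - ‖x (t + 1) - u‖ ^ 2) = ‖x 0 - u‖ ^ 2 - ‖x T - u‖ ^ 2 := by
    rw [Fin.sum_univ_eq_sum_range (fun k => ‖x k - u‖ ^ 2 - ‖x (k + 1) - u‖ ^ 2) T,
      Finset.sum_range_sub']
  rw [Finset.mul_sum]
  calc _ ≤ ∑ t : Fin T, (‖x t - u‖ ^ 2 - ‖x (t + 1) - u‖ ^ 2 + R) :=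
        Finset.sum_le_sum fun t _ => hstep' t
    _ = ‖x 0 - u‖ ^ 2 - ‖x T - u‖ ^ 2 + T * R := by
        rw [Finset.sum_add_distrib, htel]
        simp
    _ ≤ _ := by
        have h1 : ‖x 0 - u‖ ^ 2 ≤ Metric.diam Θ ^ 2 := by
          gcongr
          exact h.dist_le_diam (hx 0) hu
        have h2 := sq_nonneg ‖x T - u‖
        linarith

theorem isSmooth_globalRisk (hT : 0 < T) (hagg : ∀ t m, W.aggWt t m = p m)
    (hq : ∀ t, W.roundWt t = (T : ℝ)⁻¹) (S : W.Dataset Z) : IsSmooth L (W.globalRisk ℓ S) := by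
  rw [funext (globalRisk_eq hwt hp hagg hq S)]
  exact IsSmooth.sum_mul (fun t _ => isSmooth_roundRisk h hwt hp S t)
    (fun t _ => by positivity) (uniform_mem_stdSimplex hT).2.le

theorem convexOn_globalRisk (hagg : ∀ t m, W.aggWt t m = p m)
    (hq : ∀ t, W.roundWt t = (T : ℝ)⁻¹) (S : W.Dataset Z) :
    ConvexOn ℝ Set.univ (W.globalRisk ℓ S) := by
  rw [funext (globalRisk_eq hwt hp hagg hq S)]
  exact convexOn_sum_mul (fun t _ => convexOn_roundRisk h hwt hp S t) fun t _ => by positivity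

theorem norm_gradient_globalRisk_le (hT : 0 < T) (hB0 : 0 ≤ B) (hagg : ∀ t m, W.aggWt t m = p m)
    (hq : ∀ t, W.roundWt t = (T : ℝ)⁻¹) (S : W.Dataset Z) {θ : Par d} (hθ : θ ∈ Θ) :
    ‖gradient (W.globalRisk ℓ S) θ‖ ≤ gradBound L B := by
  refine (isSmooth_globalRisk h hwt hp hT hagg hq S).norm_gradient_le (fun x => ?_) ?_
  · rw [globalRisk_eq hwt hp hagg hq]
    exact Finset.sum_nonneg fun t _ => mul_nonneg (by positivity) (roundRisk_nonneg h hwt hp S t x)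
  · rw [globalRisk_eq hwt hp hagg hq]
    calc ∑ t, (T : ℝ)⁻¹ * W.roundRisk p ℓ S t θ ≤ ∑ t : Fin T, (T : ℝ)⁻¹ * B :=
          Finset.sum_le_sum fun t _ => mul_le_mul_of_nonneg_left
            (roundRisk_le h hwt hp hB0 S t hθ) (by positivity)
      _ = B := by rw [← Finset.sum_mul, (uniform_mem_stdSimplex hT).2, one_mul]

theorem sigmaBar_le (hT : 0 < T) (hB0 : 0 ≤ B) (hagg : ∀ t m, W.aggWt t m = p m)
    (hq : ∀ t, W.roundWt t = (T : ℝ)⁻¹) (P : Fin M → Measure Z) [∀ m, IsProbabilityMeasure (P m)] :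
    W.sigmaBar ℓ Θ P ≤ 2 * gradBound L B := by
  have hG := gradBound_nonneg L B
  have : Nonempty Θ := h.nonempty.to_subtype
  refine Real.sqrt_le_iff.2 ⟨by positivity, ?_⟩
  have : IsProbabilityMeasure (W.law P) := by unfold law; infer_instance
  have hbound : ∀ t, ∫ S, (⨆ θ : Θ, ‖gradient (W.globalRisk ℓ S) (θ : Par d)
        - ∑ m, W.aggWt t m • gradient (W.localRisk ℓ S t m) (θ : Par d)‖ ^ 2) ∂(W.law P)
      ≤ (2 * gradBound L B) ^ 2 := by
    intro t
    -- The norm bound requires no integrability: the integral of a non-integrable function is 0.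
    refine (le_abs_self _).trans ?_
    have := norm_integral_le_of_norm_le_const (μ := W.law P) (C := (2 * gradBound L B) ^ 2)
      (f := fun S => ⨆ θ : Θ, ‖gradient (W.globalRisk ℓ S) (θ : Par d)
        - ∑ m, W.aggWt t m • gradient (W.localRisk ℓ S t m) (θ : Par d)‖ ^ 2)
      (Filter.Eventually.of_forall fun S => by
        rw [Real.norm_of_nonneg (Real.iSup_nonneg fun _ => sq_nonneg _)]
        refine ciSup_le fun θ => ?_
        gcongr
        refine (norm_sub_le _ _).trans ?_
        rw [two_mul]
        refine add_le_add (norm_gradient_globalRisk_le h hwt hp hT hB0 hagg hq S θ.2) ?_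
        simp only [hagg]
        exact norm_sum_smul_le hp fun m => (isSmooth_localRisk h hwt S t m).norm_gradient_le
          (localRisk_nonneg h hwt S t m) (localRisk_le h hwt hB0 S t m θ.2))
    simpa using this
  calc _ ≤ ∑ t : Fin T, (T : ℝ)⁻¹ * (2 * gradBound L B) ^ 2 := by
        refine Finset.sum_le_sum fun t _ => ?_
        rw [hq]
        exact mul_le_mul_of_nonneg_left (hbound t) (by positivity)
    _ = _ := by rw [← Finset.sum_mul, (uniform_mem_stdSimplex hT).2, one_mul]

end Pathwise

/-! ### From regret to the optimization error. -/

section Optimization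

variable {d M T : ℕ} {Z : Type*} [MeasurableSpace Z] {W : Schedule M T} {ℓ : Par d → Z → ℝ}
  {Θ : Set (Par d)} {B : ℝ} {L : NNReal} (h : IsLoss ℓ Θ B L) (hwt : ∀ t m j, 0 ≤ W.wt t m j)
  {p : Fin M → ℝ} (hp : p ∈ stdSimplex ℝ (Fin M)) (hagg : ∀ t m, W.aggWt t m = p m)
  (hq : ∀ t, W.roundWt t = (T : ℝ)⁻¹)

include h hwt hp hagg hq

/-- The global risk of the averaged model is controlled by the regret and by the variation of the
risks between the rounds. -/
theorem globalRisk_output_sub_le (hT : 0 < T) {η : ℝ} {E : ℕ} {θ₁ : Par d} (u : Par d)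
    (hθ₁ : θ₁ ∈ Θ) (S : W.Dataset Z) {Y : Fin T → Par d → ℝ} {U : Fin T → ℝ}
    (hY : ∀ t s θ, W.roundRisk p ℓ S t θ - W.roundRisk p ℓ S s θ = Y t θ - Y s θ)
    (hU : ∀ t, ∀ a ∈ Θ, ∀ b ∈ Θ, Y t a - Y t b ≤ Metric.diam Θ * U t) :
    W.globalRisk ℓ S (W.output ℓ Θ η E θ₁ S) - W.globalRisk ℓ S u
      ≤ (T : ℝ)⁻¹ * ∑ t : Fin T, (W.roundRisk p ℓ S t (W.model ℓ Θ η E θ₁ S t)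
          - W.roundRisk p ℓ S t u) + Metric.diam Θ * ((T : ℝ)⁻¹ * ∑ t, U t) := by
  set x := W.model ℓ Θ η E θ₁ S
  set F := W.roundRisk p ℓ S
  have hx : ∀ k, x k ∈ Θ := model_mem h hθ₁ S
  have hT' : (0 : ℝ) < T := by exact_mod_cast hT
  have hunif := uniform_mem_stdSimplex hT
  have hjensen : W.globalRisk ℓ S (W.output ℓ Θ η E θ₁ S)
      ≤ ∑ t : Fin T, (T : ℝ)⁻¹ * W.globalRisk ℓ S (x t) := by
    have := (convexOn_globalRisk h hwt hp hagg hq S).map_sum_le (t := Finset.univ)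
      (w := fun _ : Fin T => (T : ℝ)⁻¹) (p := fun t => x t) (fun t _ => hunif.1 t) hunif.2
      (fun _ _ => Set.mem_univ _)
    simpa only [output, hq, smul_eq_mul] using this
  have hdrift : ∑ t : Fin T, ∑ s : Fin T, (F s (x t) - F t (x t))
      ≤ T * (Metric.diam Θ * ∑ t, U t) := by
    -- Exchanging the names of the two rounds replaces `Y t (x t)` by `Y s (x s)`. Each term now
    -- compares one function at two points of `Θ`, so its increment bound applies.
    have h1 : ∑ t : Fin T, ∑ s : Fin T, (F s (x t) - F t (x t))
        = ∑ t : Fin T, ∑ s : Fin T, (Y s (x t) - Y s (x s)) := by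
      have h2 : ∑ t : Fin T, ∑ s : Fin T, Y t (x t) = ∑ t : Fin T, ∑ s : Fin T, Y s (x s) :=
        Finset.sum_comm
      simp only [hY, F, Finset.sum_sub_distrib, h2]
    rw [h1]
    calc ∑ t : Fin T, ∑ s : Fin T, (Y s (x t) - Y s (x s))
        ≤ ∑ t : Fin T, ∑ s : Fin T, Metric.diam Θ * U s :=
          Finset.sum_le_sum fun t _ => Finset.sum_le_sum fun s _ => hU s _ (hx t) _ (hx s)
      _ = T * (Metric.diam Θ * ∑ t, U t) := by
          simp [Finset.mul_sum]
  have hsplit : ∑ t : Fin T, (T : ℝ)⁻¹ * W.globalRisk ℓ S (x t) - W.globalRisk ℓ S u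
      = (T : ℝ)⁻¹ * ∑ t : Fin T, (F t (x t) - F t u)
        + (T : ℝ)⁻¹ * ((T : ℝ)⁻¹ * ∑ t : Fin T, ∑ s : Fin T, (F s (x t) - F t (x t))) := by
    simp only [globalRisk_eq hwt hp hagg hq, Finset.sum_sub_distrib, Finset.sum_const,
      Finset.card_univ, Fintype.card_fin, nsmul_eq_mul, ← Finset.mul_sum, F]
    field_simp
    ring
  have h3 : (T : ℝ)⁻¹ * ((T : ℝ)⁻¹ * ∑ t : Fin T, ∑ s : Fin T, (F s (x t) - F t (x t)))
      ≤ Metric.diam Θ * ((T : ℝ)⁻¹ * ∑ t, U t) := by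
    calc _ ≤ (T : ℝ)⁻¹ * ((T : ℝ)⁻¹ * (T * (Metric.diam Θ * ∑ t, U t))) := by gcongr
      _ = _ := by field_simp
  linarith

/-- The optimization error of the federated algorithm on a fixed dataset. -/
theorem optimization_error_le (hT : 0 < T) (hB0 : 0 ≤ B) {η κ σ : ℝ} {E : ℕ} (hE : 0 < E)
    (hκ : 0 < κ) (hσ : σ ≤ 2 * gradBound L B) (hη : η * E = κ / √(T : ℝ) * (1 / max 1 σ))
    {θ₁ u : Par d} (hθ₁ : θ₁ ∈ Θ) (hu : u ∈ Θ) (S : W.Dataset Z) {Y : Fin T → Par d → ℝ}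
    {U : Fin T → ℝ}
    (hY : ∀ t s θ, W.roundRisk p ℓ S t θ - W.roundRisk p ℓ S s θ = Y t θ - Y s θ)
    (hU : ∀ t, ∀ a ∈ Θ, ∀ b ∈ Θ, Y t a - Y t b ≤ Metric.diam Θ * U t) (hU0 : ∀ t, 0 ≤ U t) :
    W.globalRisk ℓ S (W.output ℓ Θ η E θ₁ S) - W.globalRisk ℓ S u
      ≤ (constOne κ L B (Metric.diam Θ) E + constThree κ L B (Metric.diam Θ)) / √(T : ℝ)
        + Metric.diam Θ * ((T : ℝ)⁻¹ * ∑ t, U t) := by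
  have hT' : (0 : ℝ) < T := by exact_mod_cast hT
  have hE1 : (1 : ℝ) ≤ E := by exact_mod_cast hE
  have hG : 0 ≤ gradBound L B := gradBound_nonneg L B
  have hD : 0 ≤ Metric.diam Θ := Metric.diam_nonneg
  have hL : (0 : ℝ) ≤ L := L.coe_nonneg
  have hr : 0 < √(T : ℝ) := Real.sqrt_pos.2 hT'
  have hmax : 0 < max 1 σ := lt_max_of_lt_left one_pos
  have he0 : 0 < η * E := by rw [hη]; positivity
  have he1 : η * E ≤ κ / √(T : ℝ) := by
    rw [hη]
    refine mul_le_of_le_one_right (by positivity) ?_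
    rw [div_le_one hmax]
    exact le_max_left _ _
  have hη0 : 0 ≤ η := by
    by_contra! hneg
    exact he0.not_ge (mul_nonpos_of_nonpos_of_nonneg hneg.le (by positivity))
  have hinv : 0 ≤ 1 - (E : ℝ)⁻¹ := sub_nonneg.2 (inv_le_one_of_one_le₀ hE1)
  have hinv1 : 1 - (E : ℝ)⁻¹ ≤ 1 := sub_le_self _ (by positivity)
  have hC3 : 0 ≤ constThree κ L B (Metric.diam Θ) / √(T : ℝ) := by
    unfold constThree
    positivity
  have hsum : 0 ≤ Metric.diam Θ * ((T : ℝ)⁻¹ * ∑ t, U t) := by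
    have := Finset.sum_nonneg fun t (_ : t ∈ Finset.univ) => hU0 t
    positivity
  -- Either descent controls the local iterates, or the steps are so long that the trivial bound `G
  -- D` suffices.
  by_cases hstep : E = 1 ∨ η * L ≤ 2
  · refine (globalRisk_output_sub_le h hwt hp hagg hq hT u hθ₁ S hY hU).trans ?_
    gcongr ?_ + _
    have hreg := sum_regret_le h hwt hp hagg hB0 hη0 hE hstep hθ₁ hu S
    set A := ∑ t : Fin T, (W.roundRisk p ℓ S t (W.model ℓ Θ η E θ₁ S t) - W.roundRisk p ℓ S t u)
    set G := gradBound L B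
    set D := Metric.diam Θ
    set e := η * E
    have h1 : (T : ℝ)⁻¹ * A ≤ D ^ 2 / (2 * e * T)
        + e * (G ^ 2 / 2 + L * D * G * (1 - (E : ℝ)⁻¹)) := by
      have h2 : D ^ 2 / (2 * e * T) + e * (G ^ 2 / 2 + L * D * G * (1 - (E : ℝ)⁻¹))
          = (D ^ 2 + T * (e ^ 2 * (G ^ 2 + 2 * (L * D * G * (1 - (E : ℝ)⁻¹))))) / (2 * e * T) := by
        field_simp
      rw [h2, le_div_iff₀ (by positivity)]
      refine le_trans (le_of_eq ?_) hreg
      field_simp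
    -- The a priori bound `σ ≤ 2 G` turns the factor `max 1 σ` of the inverse step size into a
    -- constant.
    have h3 : D ^ 2 / (2 * e * T) ≤ constThree κ L B D / √(T : ℝ) := by
      have h4 : D ^ 2 / (2 * e * T) = max 1 σ / (2 * κ) * D ^ 2 / √(T : ℝ) := by
        rw [hη]
        field_simp
        rw [Real.sq_sqrt hT'.le]
      rw [h4]
      unfold constThree
      gcongr
    -- For `0 ≤ a ≤ 1` one has `a² ≤ 2 a`; this passes to the square root appearing in `constOne`.
    have h5 : 1 - (E : ℝ)⁻¹ ≤ √(2 * (1 - (E : ℝ)⁻¹)) := by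
      refine Real.le_sqrt_of_sq_le ?_
      nlinarith
    have h6 : e * (G ^ 2 / 2 + L * D * G * (1 - (E : ℝ)⁻¹)) ≤ constOne κ L B D E / √(T : ℝ) := by
      calc e * (G ^ 2 / 2 + L * D * G * (1 - (E : ℝ)⁻¹))
          ≤ κ / √(T : ℝ) * (5 / 2 * G ^ 2 + L * D * G * √(2 * (1 - (E : ℝ)⁻¹))) := by
            have : G ^ 2 / 2 ≤ 5 / 2 * G ^ 2 := by nlinarith [sq_nonneg G]
            gcongr
        _ = constOne κ L B D E / √(T : ℝ) := by
            unfold constOne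
            ring
    rw [add_div]
    linarith
  · push Not at hstep
    have hE2 : (2 : ℝ) ≤ E := by
      have : 2 ≤ E := by have := hstep.1; omega
      exact_mod_cast this
    have hout : W.output ℓ Θ η E θ₁ S ∈ Θ := output_mem h hθ₁ hT hq S
    have h1 : W.globalRisk ℓ S (W.output ℓ Θ η E θ₁ S) - W.globalRisk ℓ S u
        ≤ gradBound L B * Metric.diam Θ :=
      (le_abs_self _).trans ((abs_sub_le_of_norm_gradient_le h.convex
        (isSmooth_globalRisk h hwt hp hT hagg hq S).1
        (fun x hx => norm_gradient_globalRisk_le h hwt hp hT hB0 hagg hq S hx) hu hout).trans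
        (mul_le_mul_of_nonneg_left (h.dist_le_diam hout hu) hG))
    -- Since `η L > 2` and `η E ≤ κ / √T`, the factor `κ L / √T` is at least 1 and may multiply the
    -- trivial bound.
    have h2 : 1 ≤ κ / √(T : ℝ) * L := by
      calc (1 : ℝ) ≤ η * L := by linarith [hstep.2]
        _ ≤ η * E * L := by
          rw [mul_assoc]
          exact mul_le_mul_of_nonneg_left (le_mul_of_one_le_left hL hE1) hη0
        _ ≤ κ / √(T : ℝ) * L := mul_le_mul_of_nonneg_right he1 hL
    -- Here `E ≥ 2` is needed; equality holds at `E = 2`.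
    have h3 : 1 ≤ √(2 * (1 - (E : ℝ)⁻¹)) := by
      rw [Real.one_le_sqrt]
      have : (E : ℝ)⁻¹ ≤ 2⁻¹ := inv_anti₀ two_pos hE2
      linarith
    have h4 : gradBound L B * Metric.diam Θ ≤ constOne κ L B (Metric.diam Θ) E / √(T : ℝ) := by
      calc gradBound L B * Metric.diam Θ
          ≤ gradBound L B * Metric.diam Θ * (κ / √(T : ℝ) * L * √(2 * (1 - (E : ℝ)⁻¹))) :=
            le_mul_of_one_le_right (by positivity) (one_le_mul_of_one_le_of_one_le h2 h3)
        _ ≤ gradBound L B * Metric.diam Θ * (κ / √(T : ℝ) * L * √(2 * (1 - (E : ℝ)⁻¹)))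
            + κ / √(T : ℝ) * (5 / 2 * gradBound L B ^ 2) := le_add_of_nonneg_right (by positivity)
        _ = constOne κ L B (Metric.diam Θ) E / √(T : ℝ) := by
            unfold constOne
            ring
    rw [add_div]
    linarith

end Optimization

/-! ### Measurability of the iterates in the dataset. -/

section Measurability

variable {d M T : ℕ} {Z : Type*} [MeasurableSpace Z] {W : Schedule M T} {ℓ : Par d → Z → ℝ}
  {Θ : Set (Par d)} {B : ℝ} {L : NNReal} (h : IsLoss ℓ Θ B L)

include h

theorem measurable_localModel {η : ℝ} {E : ℕ} (t : Fin T) (m : Fin M)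
    {x : W.Dataset Z → Par d} (hx : Measurable x) :
    Measurable fun S => W.localModel ℓ η E S t m (x S) := by
  induction E with
  | zero => exact hx
  | succ E ih =>
    have hgrad : Measurable fun S => W.batchGrad ℓ S t m (W.localModel ℓ η E S t m (x S)) :=
      Finset.measurable_sum _ fun j _ =>
        (h.measurable_gradient_comp ih (measurable_pi_apply _)).fun_const_smul _
    simp only [localModel, Function.iterate_succ_apply'] at ih hgrad ⊢
    exact ih.sub (hgrad.const_smul η)

theorem measurable_model {η : ℝ} {E : ℕ} (θ₁ : Par d) (k : ℕ) :
    Measurable fun S => W.model ℓ Θ η E θ₁ S k := by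
  induction k with
  | zero => exact measurable_const
  | succ k ih =>
    by_cases hk : k < T
    · simp only [model, dif_pos hk]
      refine (lipschitzWith_proj h.convex h.closed h.nonempty).continuous.measurable.comp
        (ih.add (Finset.measurable_sum _ fun m _ => Measurable.fun_const_smul ?_ _))
      exact (measurable_localModel h ⟨k, hk⟩ m ih).sub ih
    · simpa only [model, dif_neg hk] using ih

theorem measurable_output {η : ℝ} {E : ℕ} (θ₁ : Par d) :
    Measurable fun S => W.output ℓ Θ η E θ₁ S :=
  Finset.measurable_sum _ fun t _ => (measurable_model h θ₁ t).fun_const_smul _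

end Measurability

end Schedule

/-! ### The historical/fresh scenario -/

section HistFresh

variable {M : ℕ} (T Mhist : ℕ) (c : Fin M → ℕ) (lam : Fin M → ℝ)

theorem card_filter_fin (n : ℕ) (q : ℕ → Prop) [DecidablePred q] :
    (Finset.univ.filter fun j : Fin n => q j).card = ((Finset.range n).filter q).card := by
  rw [Finset.card_filter, Finset.card_filter]
  exact Fin.sum_univ_eq_sum_range (fun k => if q k then 1 else 0) n

theorem histFresh_card_mem (t : Fin T) (m : Fin M) :
    ((histFresh T Mhist c lam).mem t m).card = c m := by
  refine (card_filter_fin (if (m : ℕ) < Mhist then c m else c m * T) (fun j =>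
    (m : ℕ) < Mhist ∨ ((t : ℕ) * c m ≤ j ∧ j < ((t : ℕ) + 1) * c m))).trans ?_
  by_cases hm : (m : ℕ) < Mhist
  · simp [hm]
  · simp only [hm, if_false, false_or]
    have hle : ((t : ℕ) + 1) * c m ≤ c m * T := by
      rw [mul_comm (c m)]
      exact Nat.mul_le_mul_right _ t.2
    have : (Finset.range (c m * T)).filter (fun j => (t : ℕ) * c m ≤ j ∧ j < ((t : ℕ) + 1) * c m)
        = Finset.Ico ((t : ℕ) * c m) (((t : ℕ) + 1) * c m) := by
      ext j
      simp only [Finset.mem_filter, Finset.mem_range, Finset.mem_Ico]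
      exact ⟨fun hj => hj.2, fun hj => ⟨hj.2.trans_le hle, hj⟩⟩
    rw [this, Nat.card_Ico, add_mul, one_mul, Nat.add_sub_cancel_left]

theorem histFresh_mem_iff (t : Fin T) (m : Fin M) (j : Fin ((histFresh T Mhist c lam).size m)) :
    j ∈ (histFresh T Mhist c lam).mem t m
      ↔ (m : ℕ) < Mhist ∨ ((t : ℕ) * c m ≤ (j : ℕ) ∧ (j : ℕ) < ((t : ℕ) + 1) * c m) :=
  Finset.mem_filter.trans ⟨fun hj => hj.2, fun hj => ⟨Finset.mem_univ _, hj⟩⟩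

theorem histFresh_size (m : Fin M) :
    (histFresh T Mhist c lam).size m = if (m : ℕ) < Mhist then c m else c m * T := rfl

/-- The number of rounds that each sample of a client spends in its memory. -/
def stay (T Mhist : ℕ) (m : Fin M) : ℕ := if (m : ℕ) < Mhist then T else 1

theorem size_mul_stay (m : Fin M) :
    (histFresh T Mhist c lam).size m * stay T Mhist m = c m * T := by
  rw [histFresh_size, stay]
  split_ifs <;> ring

theorem card_rounds (hc : ∀ m, 0 < c m) (m : Fin M) (j : Fin ((histFresh T Mhist c lam).size m)) :
    (Finset.univ.filter fun t => j ∈ (histFresh T Mhist c lam).mem t m).card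
      = stay T Mhist m := by
  simp only [histFresh_mem_iff, stay]
  by_cases hm : (m : ℕ) < Mhist
  · simp [hm]
  · simp only [hm, if_false, false_or]
    have hj : (j : ℕ) < c m * T :=
      j.2.trans_eq ((histFresh_size T Mhist c lam m).trans (if_neg hm))
    -- Rounds are counted from 0 and receive consecutive blocks of `c m` samples, so sample `j`
    -- belongs to round `j / c m` only.
    refine Finset.card_eq_one.2 ⟨⟨j / c m, Nat.div_lt_of_lt_mul hj⟩, ?_⟩
    ext t
    simp only [Finset.mem_filter, Finset.mem_univ, true_and, Finset.mem_singleton, Fin.ext_iff]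
    refine ⟨fun ht => (Nat.div_eq_of_lt_le ht.1 ht.2).symm, fun ht => ?_⟩
    rw [ht, mul_comm _ (c m), mul_comm _ (c m)]
    exact ⟨Nat.mul_div_le _ _, Nat.lt_mul_div_succ _ (hc m)⟩

theorem sum_sum_mem (hc : ∀ m, 0 < c m) (m : Fin M)
    (g : Fin ((histFresh T Mhist c lam).size m) → ℝ) :
    ∑ t, ∑ j ∈ (histFresh T Mhist c lam).mem t m, g j = stay T Mhist m * ∑ j, g j := by
  have : ∀ t, ∑ j ∈ (histFresh T Mhist c lam).mem t m, g j
      = ∑ j, if j ∈ (histFresh T Mhist c lam).mem t m then g j else 0 := fun t => by simp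
  simp only [this]
  rw [Finset.sum_comm, Finset.mul_sum]
  refine Finset.sum_congr rfl fun j _ => ?_
  rw [← Finset.sum_filter, Finset.sum_const, card_rounds T Mhist c lam hc, nsmul_eq_mul]

theorem histFresh_memWt (t : Fin T) (m : Fin M) :
    (histFresh T Mhist c lam).memWt t m = c m * lam m := by
  rw [Schedule.memWt, show (fun j => (histFresh T Mhist c lam).wt t m j) = fun _ => lam m from rfl,
    Finset.sum_const, histFresh_card_mem, nsmul_eq_mul]

variable {T Mhist c lam}
variable {p : Fin M → ℝ} (hp : p ∈ stdSimplex ℝ (Fin M))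
  (hagg : ∀ t m, (histFresh T Mhist c lam).aggWt t m = p m)

theorem histFresh_size_pos (hT : 0 < T) (hc : ∀ m, 0 < c m) (m : Fin M) :
    0 < (histFresh T Mhist c lam).size m := by
  rw [histFresh_size]
  split_ifs
  exacts [hc m, Nat.mul_pos (hc m) hT]

theorem histFresh_wt_nonneg (hlam : ∀ m, 0 ≤ lam m) (t : Fin T) (m : Fin M)
    (j : Fin ((histFresh T Mhist c lam).size m)) : 0 ≤ (histFresh T Mhist c lam).wt t m j :=
  hlam m

include hagg

theorem histFresh_mul_localRisk {d : ℕ} {Z : Type*} (hc : ∀ m, 0 < c m) (ℓ : Par d → Z → ℝ)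
    (S : (histFresh T Mhist c lam).Dataset Z) (t : Fin T) (m : Fin M) (θ : Par d) :
    p m * (histFresh T Mhist c lam).localRisk ℓ S t m θ
      = ∑ j ∈ (histFresh T Mhist c lam).mem t m, p m / c m * ℓ θ (S ⟨m, j⟩) := by
  have hc' : (c m : ℝ) ≠ 0 := by exact_mod_cast (hc m).ne'
  -- The normalised weights are then `0 / 0 = 0` instead of `1 / c m`, but `p m` vanishes as well.
  by_cases h0 : lam m = 0
  · have : p m = 0 := by rw [← hagg t m, Schedule.aggWt, histFresh_memWt, h0]; simp
    simp [this]
  · rw [Schedule.localRisk_eq, Finset.mul_sum]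
    refine Finset.sum_congr rfl fun j _ => ?_
    rw [histFresh_memWt, show (histFresh T Mhist c lam).wt t m j = lam m from rfl]
    field_simp

include hp

theorem histFresh_roundWt (hT : 0 < T) (t : Fin T) :
    (histFresh T Mhist c lam).roundWt t = (T : ℝ)⁻¹ := by
  have hne : ∑ m, (c m : ℝ) * lam m ≠ 0 := by
    intro h0
    have : ∑ m, p m = 0 := Finset.sum_eq_zero fun m _ => by
      rw [← hagg t m, Schedule.aggWt]
      simp only [histFresh_memWt, h0, div_zero]
    rw [hp.2] at this
    exact one_ne_zero this
  have hT' : (T : ℝ) ≠ 0 := by exact_mod_cast hT.ne'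
  simp only [Schedule.roundWt, histFresh_memWt, Finset.sum_const, Finset.card_univ,
    Fintype.card_fin, nsmul_eq_mul]
  field_simp

/-- In each round a sample in memory counts `p m / c m`. It stays for `stay` rounds out of `T`, and
`size * stay = c * T` makes the average weight `p m / size m` for both kinds of client. -/
theorem histFresh_globalRisk {d : ℕ} {Z : Type*} (hT : 0 < T) (hc : ∀ m, 0 < c m)
    (hlam : ∀ m, 0 ≤ lam m) (ℓ : Par d → Z → ℝ) (S : (histFresh T Mhist c lam).Dataset Z)
    (θ : Par d) :
    (histFresh T Mhist c lam).globalRisk ℓ S θ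
      = ∑ i, p i.1 / (histFresh T Mhist c lam).size i.1 * ℓ θ (S i) := by
  rw [Schedule.globalRisk_eq (histFresh_wt_nonneg hlam) hp hagg
    (histFresh_roundWt hp hagg hT), ← Finset.mul_sum, Fintype.sum_sigma]
  simp only [Schedule.roundRisk, histFresh_mul_localRisk hagg hc]
  rw [Finset.sum_comm, Finset.mul_sum]
  refine Finset.sum_congr rfl fun m _ => ?_
  rw [sum_sum_mem T Mhist c lam hc m fun j => p m / c m * ℓ θ (S ⟨m, j⟩), ← Finset.mul_sum,
    ← Finset.mul_sum]
  have h1 : ((histFresh T Mhist c lam).size m : ℝ) * stay T Mhist m = c m * T := by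
    exact_mod_cast size_mul_stay T Mhist c lam m
  have hcT : (c m : ℝ) * T ≠ 0 := by
    have := hc m
    positivity
  have hs : ((histFresh T Mhist c lam).size m : ℝ) ≠ 0 := left_ne_zero_of_mul (h1 ▸ hcT)
  have hc' := left_ne_zero_of_mul hcT
  have hT' := right_ne_zero_of_mul hcT
  field_simp
  linear_combination p m * (∑ j, ℓ θ (S ⟨m, j⟩)) * h1

end HistFresh

/-! ### Gradient noise -/

section Noise

variable {d : ℕ} {Z : Type*} [MeasurableSpace Z]

/-- The largest deviation of the gradient at a sample from the gradient of the risk. -/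
def gradDev (ℓ : Par d → Z → ℝ) (Θ : Set (Par d)) (P : Measure Z) (z : Z) : ℝ :=
  √(⨆ θ : Θ, ‖gradient (fun x => ℓ x z) (θ : Par d) - gradient (risk ℓ P) (θ : Par d)‖ ^ 2)

theorem gradDev_sq (ℓ : Par d → Z → ℝ) (Θ : Set (Par d)) (P : Measure Z) (z : Z) :
    gradDev ℓ Θ P z ^ 2
    = ⨆ θ : Θ, ‖gradient (fun x => ℓ x z) (θ : Par d) - gradient (risk ℓ P) (θ : Par d)‖ ^ 2 :=
  Real.sq_sqrt (Real.iSup_nonneg fun _ => sq_nonneg _)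

variable {ℓ : Par d → Z → ℝ} {Θ : Set (Par d)} {B : ℝ} {L : NNReal} (h : IsLoss ℓ Θ B L)

theorem gradDev_nonneg (P : Measure Z) (z : Z) : 0 ≤ gradDev ℓ Θ P z := Real.sqrt_nonneg _

include h

namespace IsLoss

variable (P : Measure Z) [IsProbabilityMeasure P]

theorem continuous_gradient_sub (z : Z) : Continuous fun θ =>
    ‖gradient (fun x => ℓ x z) θ - gradient (risk ℓ P) θ‖ ^ 2 :=
  (((h.continuous_gradient z).sub (h.isSmooth_risk P).2.continuous).norm).pow 2

theorem measurable_gradDev : Measurable (gradDev ℓ Θ P) :=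
  (measurable_iSup_of_isCompact h.isCompact h.nonempty (h.continuous_gradient_sub P)
    fun θ => ((h.measurable_gradient θ).sub_const _).norm.pow_const 2).sqrt

theorem norm_gradient_sub_le {θ : Par d} (hθ : θ ∈ Θ) (z : Z) :
    ‖gradient (fun x => ℓ x z) θ - gradient (risk ℓ P) θ‖ ≤ gradDev ℓ Θ P z :=
  Real.le_sqrt_of_sq_le (le_iSup_of_isCompact h.isCompact (h.continuous_gradient_sub P z) hθ)

theorem gradDev_le (z : Z) : gradDev ℓ Θ P z ≤ 2 * gradBound L B := by
  have hG := gradBound_nonneg L B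
  have : Nonempty Θ := h.nonempty.to_subtype
  refine Real.sqrt_le_iff.2 ⟨by positivity, ciSup_le fun θ => ?_⟩
  gcongr
  refine (norm_sub_le _ _).trans ?_
  rw [two_mul]
  exact add_le_add (h.norm_gradient_le θ.2 z)
    ((h.isSmooth_risk P).norm_gradient_le (h.risk_nonneg P) (h.risk_le P θ.2))

theorem integrable_gradDev : Integrable (gradDev ℓ Θ P) P :=
  integrable_of_measurable_of_abs_le (h.measurable_gradDev P) fun z => by
    rw [abs_of_nonneg (gradDev_nonneg P z)]
    exact h.gradDev_le P z

/-- Mean value inequality on the convex set `Θ` for the centred loss, whose gradient is the gradient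
deviation. -/
theorem abs_deviation_sub_le (z : Z) {a b : Par d} (ha : a ∈ Θ) (hb : b ∈ Θ) :
    (ℓ a z - risk ℓ P a) - (ℓ b z - risk ℓ P b) ≤ Metric.diam Θ * gradDev ℓ Θ P z := by
  have hgrad : ∀ x, HasGradientAt (fun y => ℓ y z - risk ℓ P y)
      (gradient (fun x => ℓ x z) x - gradient (risk ℓ P) x) x := fun x =>
    hasGradientAt_sub ((h.smooth z).1 x).hasGradientAt ((h.isSmooth_risk P).1 x).hasGradientAt
  refine (le_abs_self _).trans ((abs_sub_le_of_norm_gradient_le h.convex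
    (fun x => (hgrad x).differentiableAt) (C := gradDev ℓ Θ P z) (fun x hx => ?_) hb ha).trans ?_)
  · rw [(hgrad x).gradient]
    exact h.norm_gradient_sub_le P hx z
  · rw [mul_comm]
    exact mul_le_mul_of_nonneg_right (h.dist_le_diam ha hb) (gradDev_nonneg P z)

omit [IsProbabilityMeasure P] in
-- `gradDev` is a square root precisely so that its second moment is the quantity maximised in
-- `sigmaZero`.
theorem integral_gradDev_le {M : ℕ} (P : Fin M → Measure Z) [∀ m, IsProbabilityMeasure (P m)]
    (m : Fin M) : ∫ z, gradDev ℓ Θ (P m) z ∂(P m) ≤ sigmaZero ℓ Θ P := by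
  have hint : Integrable (fun z => gradDev ℓ Θ (P m) z ^ 2) (P m) :=
    integrable_of_measurable_of_abs_le ((h.measurable_gradDev (P m)).pow_const 2) fun z => by
      rw [abs_of_nonneg (sq_nonneg _)]
      exact pow_le_pow_left₀ (gradDev_nonneg _ z) (h.gradDev_le (P m) z) 2
  refine (integral_le_sqrt_integral_sq (h.integrable_gradDev (P m)) hint).trans ?_
  refine Real.sqrt_le_sqrt ?_
  simp only [gradDev_sq]
  exact le_ciSup (f := fun m => ∫ z, (⨆ θ : Θ,
      ‖gradient (fun x => ℓ x z) (θ : Par d) - gradient (risk ℓ (P m)) (θ : Par d)‖ ^ 2) ∂(P m))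
    (Set.finite_range _).bddAbove m

end IsLoss

end Noise

/-! ### Mixtures of the client distributions -/

section Mixture

variable {d M : ℕ} {Z : Type*} [MeasurableSpace Z] {ℓ : Par d → Z → ℝ} {Θ : Set (Par d)}
  {B : ℝ} {L : NNReal} (h : IsLoss ℓ Θ B L) (P : Fin M → Measure Z)
  [∀ m, IsProbabilityMeasure (P m)]

include h

theorem IsLoss.risk_mixture {α : Fin M → ℝ} (hα : ∀ m, 0 ≤ α m) (θ : Par d) :
    risk ℓ (mixture α P) θ = ∑ m, α m * risk ℓ (P m) θ := by
  unfold risk mixture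
  rw [integral_finsetSum_measure fun m _ =>
    (h.integrable (P m) θ).smul_measure ENNReal.ofReal_ne_top]
  refine Finset.sum_congr rfl fun m _ => ?_
  rw [integral_smul_measure, ENNReal.toReal_ofReal (hα m), smul_eq_mul]

theorem IsLoss.abs_risk_sub_le_maxDisc (m m' : Fin M) {θ : Par d} (hθ : θ ∈ Θ) :
    |risk ℓ (P m) θ - risk ℓ (P m') θ| ≤ maxDisc ℓ Θ P := by
  have h1 : |risk ℓ (P m) θ - risk ℓ (P m') θ| ≤ disc ℓ Θ (P m) (P m') :=
    le_iSup_of_isCompact (f := fun θ => |risk ℓ (P m) θ - risk ℓ (P m') θ|) h.isCompact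
      (((h.continuous_risk (P m)).sub (h.continuous_risk (P m'))).abs) hθ
  have h2 : disc ℓ Θ (P m) (P m') ≤ ⨆ m', disc ℓ Θ (P m) (P m') :=
    le_ciSup (f := fun m' => disc ℓ Θ (P m) (P m')) (Set.finite_range _).bddAbove m'
  exact h1.trans (h2.trans
    (le_ciSup (f := fun m => ⨆ m', disc ℓ Θ (P m) (P m')) (Set.finite_range _).bddAbove m))

/-- The excess risks for two vectors of mixture weights. -/
theorem IsLoss.excess_risk_le {α p : Fin M → ℝ} (hα : α ∈ stdSimplex ℝ (Fin M))
    (hp : p ∈ stdSimplex ℝ (Fin M)) (m₀ : Fin M) {a u : Par d} (ha : a ∈ Θ) (hu : u ∈ Θ) :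
    ∑ m, α m * risk ℓ (P m) a - ∑ m, α m * risk ℓ (P m) u
      ≤ ∑ m, p m * risk ℓ (P m) a - ∑ m, p m * risk ℓ (P m) u
        + 2 * maxDisc ℓ Θ P * ∑ m, |α m - p m| := by
  have key : ∀ θ ∈ Θ, |∑ m, α m * risk ℓ (P m) θ - ∑ m, p m * risk ℓ (P m) θ|
      ≤ maxDisc ℓ Θ P * ∑ m, |α m - p m| := by
    intro θ hθ
    -- Both weight vectors have sum 1, so the risk of a reference client can be subtracted, leaving
    -- only risk differences between two clients.
    have h1 : ∑ m, α m * risk ℓ (P m) θ - ∑ m, p m * risk ℓ (P m) θ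
        = ∑ m, (α m - p m) * (risk ℓ (P m) θ - risk ℓ (P m₀) θ) := by
      simp only [mul_sub, Finset.sum_sub_distrib, ← Finset.sum_mul, hα.2, hp.2, sub_mul]
      ring
    rw [h1, Finset.mul_sum]
    refine (Finset.abs_sum_le_sum_abs _ _).trans (Finset.sum_le_sum fun m _ => ?_)
    rw [abs_mul, mul_comm]
    exact mul_le_mul_of_nonneg_right (h.abs_risk_sub_le_maxDisc P m m₀ hθ) (abs_nonneg _)
  have h1 := (abs_le.1 (key a ha)).2
  have h2 := (abs_le.1 (key u hu)).1
  linarith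

end Mixture

/-! ### The error in the historical/fresh scenario -/

section Error

variable {d M T Mhist : ℕ} {Z : Type*} [MeasurableSpace Z] {ℓ : Par d → Z → ℝ} {Θ : Set (Par d)}
  {B : ℝ} {L : NNReal} {c : Fin M → ℕ} {lam p : Fin M → ℝ}

/-- The deviation of the fresh part of the risk of round `t` from its mean. -/
def freshRisk (Mhist : ℕ) (c : Fin M → ℕ) (lam p : Fin M → ℝ) (ℓ : Par d → Z → ℝ)
    (P : Fin M → Measure Z) (S : (histFresh T Mhist c lam).Dataset Z) (t : Fin T) (θ : Par d) : ℝ :=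
  ∑ m ∈ Finset.univ.filter (fun m : Fin M => Mhist ≤ (m : ℕ)),
    ∑ j ∈ (histFresh T Mhist c lam).mem t m, p m / c m * (ℓ θ (S ⟨m, j⟩) - risk ℓ (P m) θ)

/-- The weighted gradient deviation of the fresh samples of round `t`. -/
def freshDev (Mhist : ℕ) (c : Fin M → ℕ) (lam p : Fin M → ℝ) (ℓ : Par d → Z → ℝ) (Θ : Set (Par d))
    (P : Fin M → Measure Z) (S : (histFresh T Mhist c lam).Dataset Z) (t : Fin T) : ℝ :=
  ∑ m ∈ Finset.univ.filter (fun m : Fin M => Mhist ≤ (m : ℕ)),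
    ∑ j ∈ (histFresh T Mhist c lam).mem t m, p m / c m * gradDev ℓ Θ (P m) (S ⟨m, j⟩)

/-- Historical memories never change, and the centring is the same in all rounds because each memory
holds `c m` samples; both drop out of the difference. Centring makes the increments depend on
`gradDev` instead of `G`. -/
theorem roundRisk_sub_roundRisk (hc : ∀ m, 0 < c m)
    (hagg : ∀ t m, (histFresh T Mhist c lam).aggWt t m = p m) (P : Fin M → Measure Z)
    (S : (histFresh T Mhist c lam).Dataset Z) (t s : Fin T) (θ : Par d) :
    (histFresh T Mhist c lam).roundRisk p ℓ S t θ - (histFresh T Mhist c lam).roundRisk p ℓ S s θ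
      = freshRisk Mhist c lam p ℓ P S t θ - freshRisk Mhist c lam p ℓ P S s θ := by
  unfold Schedule.roundRisk freshRisk
  simp only [histFresh_mul_localRisk hagg hc, mul_sub, Finset.sum_sub_distrib, Finset.sum_const,
    histFresh_card_mem]
  rw [← Finset.sum_filter_add_sum_filter_not Finset.univ (fun m : Fin M => Mhist ≤ (m : ℕ)),
    ← Finset.sum_filter_add_sum_filter_not Finset.univ (fun m : Fin M => Mhist ≤ (m : ℕ))
      (fun m => ∑ j ∈ (histFresh T Mhist c lam).mem s m, p m / c m * ℓ θ (S ⟨m, j⟩))]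
  have hist : ∑ m ∈ Finset.univ.filter (fun m : Fin M => ¬ Mhist ≤ (m : ℕ)),
        ∑ j ∈ (histFresh T Mhist c lam).mem t m, p m / c m * ℓ θ (S ⟨m, j⟩)
      = ∑ m ∈ Finset.univ.filter (fun m : Fin M => ¬ Mhist ≤ (m : ℕ)),
        ∑ j ∈ (histFresh T Mhist c lam).mem s m, p m / c m * ℓ θ (S ⟨m, j⟩) := by
    refine Finset.sum_congr rfl fun m hm => Finset.sum_congr ?_ fun _ _ => rfl
    have hm' := not_le.1 (Finset.mem_filter.1 hm).2
    ext j
    simp only [histFresh_mem_iff, hm', true_or]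
  rw [hist]
  ring

theorem IsLoss.freshRisk_sub_le (h : IsLoss ℓ Θ B L) (hp : p ∈ stdSimplex ℝ (Fin M))
    (P : Fin M → Measure Z) [∀ m, IsProbabilityMeasure (P m)]
    (S : (histFresh T Mhist c lam).Dataset Z) (t : Fin T) {a b : Par d} (ha : a ∈ Θ) (hb : b ∈ Θ) :
    freshRisk Mhist c lam p ℓ P S t a - freshRisk Mhist c lam p ℓ P S t b
      ≤ Metric.diam Θ * freshDev Mhist c lam p ℓ Θ P S t := by
  unfold freshRisk freshDev
  rw [← Finset.sum_sub_distrib, Finset.mul_sum]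
  refine Finset.sum_le_sum fun m _ => ?_
  rw [← Finset.sum_sub_distrib, Finset.mul_sum]
  refine Finset.sum_le_sum fun j _ => ?_
  rw [← mul_sub, mul_left_comm]
  exact mul_le_mul_of_nonneg_left (h.abs_deviation_sub_le (P m) _ ha hb)
    (div_nonneg (hp.1 m) (Nat.cast_nonneg _))

theorem freshDev_nonneg (hp : p ∈ stdSimplex ℝ (Fin M)) (P : Fin M → Measure Z)
    (S : (histFresh T Mhist c lam).Dataset Z) (t : Fin T) :
    0 ≤ freshDev Mhist c lam p ℓ Θ P S t :=
  Finset.sum_nonneg fun m _ => Finset.sum_nonneg fun _ _ =>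
    mul_nonneg (div_nonneg (hp.1 m) (Nat.cast_nonneg _)) (gradDev_nonneg _ _)

/-- Cauchy–Schwarz over the `M - Mhist` fresh clients. -/
theorem sum_fresh_le (hM : Mhist ≤ M) (p : Fin M → ℝ) :
    ∑ m ∈ Finset.univ.filter (fun m : Fin M => Mhist ≤ (m : ℕ)), p m
      ≤ √((M : ℝ) - (Mhist : ℝ))
        * √(∑ m ∈ Finset.univ.filter (fun m : Fin M => Mhist ≤ (m : ℕ)), p m ^ 2) := by
  have hcard : (Finset.univ.filter (fun m : Fin M => Mhist ≤ (m : ℕ))).card = M - Mhist := by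
    rw [card_filter_fin M fun k => Mhist ≤ k]
    have : (Finset.range M).filter (fun k => Mhist ≤ k) = Finset.Ico Mhist M := by
      ext k
      simp [and_comm]
    rw [this, Nat.card_Ico]
  have h1 := sq_sum_le_card_mul_sum_sq
    (s := Finset.univ.filter (fun m : Fin M => Mhist ≤ (m : ℕ))) (f := p)
  rw [hcard, Nat.cast_sub hM] at h1
  rw [← Real.sqrt_mul (sub_nonneg.2 (by exact_mod_cast hM))]
  exact Real.le_sqrt_of_sq_le h1

/-! ### Expected gradient deviation of the fresh clients. -/

section Expectation

variable (P : Fin M → Measure Z) [∀ m, IsProbabilityMeasure (P m)]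

instance (W : Schedule M T) : IsProbabilityMeasure (W.law P) := by
  unfold Schedule.law
  infer_instance

theorem IsLoss.integrable_gradDev_comp (h : IsLoss ℓ Θ B L) (W : Schedule M T)
    (i : (m : Fin M) × Fin (W.size m)) :
    Integrable (fun S : W.Dataset Z => gradDev ℓ Θ (P i.1) (S i)) (W.law P) :=
  integrable_of_measurable_of_abs_le ((h.measurable_gradDev _).comp (measurable_pi_apply i))
    fun S => by
      rw [abs_of_nonneg (gradDev_nonneg _ _)]
      exact h.gradDev_le _ _

theorem IsLoss.integrable_freshDev (h : IsLoss ℓ Θ B L) (t : Fin T) :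
    Integrable (fun S => freshDev Mhist c lam p ℓ Θ P S t) ((histFresh T Mhist c lam).law P) :=
  integrable_finsetSum _ fun m _ => integrable_finsetSum _ fun j _ =>
    (h.integrable_gradDev_comp P (histFresh T Mhist c lam) ⟨m, j⟩).const_mul _

theorem sigmaZero_nonneg (ℓ : Par d → Z → ℝ) (Θ : Set (Par d)) (P : Fin M → Measure Z) :
    0 ≤ sigmaZero ℓ Θ P := Real.sqrt_nonneg _

/-- Only the marginal law of each sample enters; the weights `p m / c m` of a memory add up to `p
m`. -/
theorem IsLoss.integral_freshDev_le (h : IsLoss ℓ Θ B L) (hM : Mhist ≤ M) (hc : ∀ m, 0 < c m)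
    (hp : p ∈ stdSimplex ℝ (Fin M)) (t : Fin T) :
    ∫ S, freshDev Mhist c lam p ℓ Θ P S t ∂((histFresh T Mhist c lam).law P)
      ≤ sigmaZero ℓ Θ P * √((M : ℝ) - (Mhist : ℝ))
        * √(∑ m ∈ Finset.univ.filter (fun m : Fin M => Mhist ≤ (m : ℕ)), p m ^ 2) := by
  set W := histFresh T Mhist c lam
  have hint : ∀ m j, Integrable
      (fun S : W.Dataset Z => p m / c m * gradDev ℓ Θ (P m) (S ⟨m, j⟩)) (W.law P) :=
    fun m j => (h.integrable_gradDev_comp P W ⟨m, j⟩).const_mul _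
  have heval : ∀ m j, ∫ S : W.Dataset Z, gradDev ℓ Θ (P m) (S ⟨m, j⟩) ∂(W.law P)
      ≤ sigmaZero ℓ Θ P := fun m j =>
    (integral_comp_eval (μ := fun i : (m : Fin M) × Fin (W.size m) => P i.1) (i := ⟨m, j⟩)
      (h.measurable_gradDev (P m)).aestronglyMeasurable).trans_le (h.integral_gradDev_le P m)
  unfold freshDev
  rw [integral_finsetSum _ fun m _ => integrable_finsetSum _ fun j _ => hint m j]
  calc _ ≤ ∑ m ∈ Finset.univ.filter (fun m : Fin M => Mhist ≤ (m : ℕ)),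
        p m * sigmaZero ℓ Θ P := by
        refine Finset.sum_le_sum fun m _ => ?_
        rw [integral_finsetSum _ fun j _ => hint m j]
        calc _ ≤ ∑ j ∈ W.mem t m, p m / c m * sigmaZero ℓ Θ P := by
              refine Finset.sum_le_sum fun j _ => ?_
              rw [integral_const_mul]
              exact mul_le_mul_of_nonneg_left (heval m j)
                (div_nonneg (hp.1 m) (Nat.cast_nonneg _))
          _ = p m * sigmaZero ℓ Θ P := by
              have hc' : (c m : ℝ) ≠ 0 := by exact_mod_cast (hc m).ne'
              rw [Finset.sum_const, histFresh_card_mem, nsmul_eq_mul]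
              field_simp
    _ ≤ _ := by
        rw [← Finset.sum_mul, mul_comm, mul_assoc]
        exact mul_le_mul_of_nonneg_left (sum_fresh_le hM p) (sigmaZero_nonneg ℓ Θ P)

end Expectation

theorem sum_weight_sigma {W : Schedule M T} (hsize : ∀ m, 0 < W.size m) (p r : Fin M → ℝ) :
    ∑ i : (m : Fin M) × Fin (W.size m), p i.1 / W.size i.1 * r i.1 = ∑ m, p m * r m := by
  rw [Fintype.sum_sigma]
  refine Finset.sum_congr rfl fun m _ => ?_
  have : (W.size m : ℝ) ≠ 0 := by exact_mod_cast (hsize m).ne'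
  simp only [Finset.sum_const, Finset.card_univ, Fintype.card_fin, nsmul_eq_mul]
  field_simp

/-- The sum of `p m ^ 2 / n_m` is `N` times the sum of the squared sample weights. The constant `2
√2` from symmetrization is rounded up to 4. -/
theorem generalization_term_le {W : Schedule M T} (hsize : ∀ m, 0 < W.size m)
    (hN : 0 < W.total) (p : Fin M → ℝ) {v : ℕ} (hvN : v ≤ W.total) (hB0 : 0 ≤ B) :
    2 * (B * √(2 * (v * (1 + Real.log (Fintype.card ((m : Fin M) × Fin (W.size m)) / v)))
        * ∑ i : (m : Fin M) × Fin (W.size m), (p i.1 / W.size i.1) ^ 2))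
      ≤ 4 * B * √(1 + Real.log ((W.total : ℝ) / (v : ℝ))) * √((v : ℝ) / (W.total : ℝ))
            * √(∑ m, p m ^ 2 / W.relSize m) := by
  have hcard : Fintype.card ((m : Fin M) × Fin (W.size m)) = W.total := by
    simp [Schedule.total]
  have hN' : (0 : ℝ) < W.total := by exact_mod_cast hN
  set A := ∑ i : (m : Fin M) × Fin (W.size m), (p i.1 / W.size i.1) ^ 2
  have hA : ∑ m, p m ^ 2 / W.relSize m = W.total * A := by
    have h1 := sum_weight_sigma hsize p fun m => p m / W.size m
    have h2 : A = ∑ m, p m * (p m / W.size m) := by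
      rw [← h1]
      exact Finset.sum_congr rfl fun i _ => sq _
    rw [h2, Finset.mul_sum]
    refine Finset.sum_congr rfl fun m _ => ?_
    have : (W.size m : ℝ) ≠ 0 := by exact_mod_cast (hsize m).ne'
    rw [Schedule.relSize]
    field_simp
  rw [hcard, hA]
  set x := 1 + Real.log ((W.total : ℝ) / (v : ℝ))
  have hH : 0 ≤ (v : ℝ) * x := entropy_nonneg hvN
  have hA0 : 0 ≤ A := Finset.sum_nonneg fun _ _ => sq_nonneg _
  have h1 : √((v : ℝ) / (W.total : ℝ)) * √(W.total * A) = √(v * A) := by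
    rw [← Real.sqrt_mul (by positivity)]
    congr 1
    field_simp
  have h2 : √x * √(v * A) = √(v * x * A) := by
    rw [Real.sqrt_mul (Nat.cast_nonneg v), mul_left_comm, ← mul_assoc,
      ← Real.sqrt_mul (Nat.cast_nonneg v), ← Real.sqrt_mul hH]
  have h3 : √(2 * (v * x) * A) ≤ 2 * √(v * x * A) := by
    rw [mul_assoc, Real.sqrt_mul zero_le_two]
    refine mul_le_mul_of_nonneg_right ?_ (Real.sqrt_nonneg _)
    rw [Real.sqrt_le_left zero_le_two]
    norm_num
  calc _ ≤ 2 * (B * (2 * √(v * x * A))) := by gcongr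
    _ = 4 * B * (√x * (√((v : ℝ) / (W.total : ℝ)) * √(W.total * A))) := by
        rw [h1, h2]
        ring
    _ = _ := by ring

end Error

/-! ### The error decomposition. -/

section TrueError

variable {d M T Mhist : ℕ} {Z : Type*} [MeasurableSpace Z] {ℓ : Par d → Z → ℝ} {Θ : Set (Par d)}
  {B : ℝ} {L : NNReal} (h : IsLoss ℓ Θ B L) (P : Fin M → Measure Z)
  [∀ m, IsProbabilityMeasure (P m)]

include h

theorem IsLoss.integrable_risk_output {W : Schedule M T} (m : Fin M) {η : ℝ} {E : ℕ} {θ₁ : Par d}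
    (hθ₁ : θ₁ ∈ Θ) (hT : 0 < T) (hq : ∀ t, W.roundWt t = (T : ℝ)⁻¹) :
    Integrable (fun S => risk ℓ (P m) (W.output ℓ Θ η E θ₁ S)) (W.law P) :=
  integrable_of_measurable_of_abs_le
    ((h.continuous_risk (P m)).measurable.comp (Schedule.measurable_output h θ₁)) fun S => by
      rw [abs_of_nonneg (h.risk_nonneg _ _)]
      exact h.risk_le _ (Schedule.output_mem h hθ₁ hT hq S)

theorem IsLoss.integrable_risk_mixture_output {W : Schedule M T} {α : Fin M → ℝ}
    (hα : ∀ m, 0 ≤ α m) {η : ℝ} {E : ℕ} {θ₁ : Par d} (hθ₁ : θ₁ ∈ Θ) (hT : 0 < T)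
    (hq : ∀ t, W.roundWt t = (T : ℝ)⁻¹) :
    Integrable (fun S => risk ℓ (mixture α P) (W.output ℓ Θ η E θ₁ S)) (W.law P) := by
  simp only [h.risk_mixture P hα]
  exact integrable_finsetSum _ fun m _ => (h.integrable_risk_output P m hθ₁ hT hq).const_mul _

theorem IsLoss.integrable_sum_loss {W : Schedule M T} (w : (m : Fin M) × Fin (W.size m) → ℝ)
    {τ : W.Dataset Z → Par d} (hτ : Measurable τ) (hτΘ : ∀ S, τ S ∈ Θ) :
    Integrable (fun S => ∑ i, w i * ℓ (τ S) (S i)) (W.law P) :=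
  integrable_finsetSum _ fun i _ => (integrable_of_measurable_of_abs_le
    (h.measurable_comp hτ (measurable_pi_apply i)) fun S => by
      rw [abs_of_nonneg (h.nonneg _ _)]
      exact h.le _ (hτΘ S) _).const_mul _

/-- At a parameter fixed before sampling, the weighted empirical risk is unbiased. -/
theorem IsLoss.integral_sum_loss {W : Schedule M T} (hsize : ∀ m, 0 < W.size m) (p : Fin M → ℝ)
    (u : Par d) : ∫ S, ∑ i, p i.1 / W.size i.1 * ℓ u (S i) ∂(W.law P)
      = ∑ m, p m * risk ℓ (P m) u := by
  rw [← sum_weight_sigma hsize, integral_finsetSum]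
  · refine Finset.sum_congr rfl fun i _ => ?_
    rw [integral_const_mul]
    congr 1
    exact integral_comp_eval (μ := fun i : (m : Fin M) × Fin (W.size m) => P i.1)
      (h.meas u).aestronglyMeasurable
  · exact fun i _ => (integrable_of_measurable_of_abs_le
      (f := fun S : W.Dataset Z => ℓ u (S i)) ((h.meas u).comp (measurable_pi_apply i))
      fun S => (h.exists_bound u).choose_spec (S i)).const_mul _

theorem IsLoss.trueError_le {c : Fin M → ℕ} {lam p α : Fin M → ℝ} (hT : 0 < T) (hM : Mhist ≤ M)
    (hc : ∀ m, 0 < c m) (hlam : ∀ m, 0 ≤ lam m) (hp : p ∈ stdSimplex ℝ (Fin M))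
    (hagg : ∀ t m, (histFresh T Mhist c lam).aggWt t m = p m) (hα : α ∈ stdSimplex ℝ (Fin M))
    {v : ℕ} (hv : hypVCDim ℓ Θ ≤ v) (hvN : v ≤ (histFresh T Mhist c lam).total) {κ η : ℝ} {E : ℕ}
    (hE : 0 < E) (hκ : 0 < κ) (hη : η * (E : ℝ) = κ / √(T : ℝ)
      * (1 / max 1 ((histFresh T Mhist c lam).sigmaBar ℓ Θ P))) {θ₁ : Par d} (hθ₁ : θ₁ ∈ Θ) :
    (histFresh T Mhist c lam).trueError ℓ Θ P α η E θ₁ ≤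
      (constOne κ L B (Metric.diam Θ) E + constThree κ L B (Metric.diam Θ)) / √(T : ℝ)
        + Metric.diam Θ * (sigmaZero ℓ Θ P * √((M : ℝ) - (Mhist : ℝ))
            * √(∑ m ∈ Finset.univ.filter (fun m : Fin M => Mhist ≤ (m : ℕ)), p m ^ 2))
        + 2 * maxDisc ℓ Θ P * (∑ m, |α m - p m|)
        + 4 * B * √(1 + Real.log (((histFresh T Mhist c lam).total : ℝ) / (v : ℝ)))
            * √((v : ℝ) / ((histFresh T Mhist c lam).total : ℝ))
            * √(∑ m, p m ^ 2 / (histFresh T Mhist c lam).relSize m) := by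
  set W := histFresh T Mhist c lam
  -- Weights with sum 1 require a client; its probability measure makes `Z` nonempty, whence `0 ≤
  -- B`.
  obtain ⟨m₀⟩ : Nonempty (Fin M) := by
    by_contra hempty
    rw [not_nonempty_iff] at hempty
    have := hp.2
    rw [Finset.univ_eq_empty, Finset.sum_empty] at this
    exact zero_ne_one this
  have : Nonempty Z := nonempty_of_isProbabilityMeasure (P m₀)
  have : Nonempty Θ := h.nonempty.to_subtype
  have hB0 := h.bound_nonneg
  have hT' : (T : ℝ) ≠ 0 := by exact_mod_cast hT.ne'
  have hwt : ∀ t m j, 0 ≤ W.wt t m j := histFresh_wt_nonneg hlam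
  have hq : ∀ t, W.roundWt t = (T : ℝ)⁻¹ := histFresh_roundWt hp hagg hT
  have hsize : ∀ m, 0 < W.size m := histFresh_size_pos hT hc
  have hN : 0 < W.total :=
    (hsize m₀).trans_le (Finset.single_le_sum (fun m _ => Nat.zero_le _) (Finset.mem_univ m₀))
  set out := fun S => W.output ℓ Θ η E θ₁ S
  have hout : ∀ S, out S ∈ Θ := Schedule.output_mem h hθ₁ hT hq
  have houtm : Measurable out := Schedule.measurable_output h θ₁
  obtain ⟨u, hu, humin⟩ : ∃ u ∈ Θ, ∀ θ ∈ Θ, ∑ m, α m * risk ℓ (P m) u ≤ ∑ m, α m * risk ℓ (P m) θ :=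
    h.isCompact.exists_isMinOn h.nonempty (continuous_finsetSum _ fun m _ =>
      continuous_const.mul (h.continuous_risk (P m))).continuousOn
  set w : (m : Fin M) × Fin (W.size m) → ℝ := fun i => p i.1 / W.size i.1
  set gap := fun S : W.Dataset Z => ∑ i, w i * (risk ℓ (P i.1) (out S) - ℓ (out S) (S i))
  set opt := fun S : W.Dataset Z => W.globalRisk ℓ S (out S) - W.globalRisk ℓ S u
  have hglobal : ∀ S θ, W.globalRisk ℓ S θ = ∑ i, w i * ℓ θ (S i) :=
    histFresh_globalRisk hp hagg hT hc hlam ℓ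
  have hlossout : Integrable (fun S => ∑ i, w i * ℓ (out S) (S i)) (W.law P) :=
    h.integrable_sum_loss P w houtm hout
  have hlossu : Integrable (fun S => ∑ i, w i * ℓ u (S i)) (W.law P) :=
    h.integrable_sum_loss P w measurable_const fun _ => hu
  have hriskout : Integrable (fun S => ∑ m, p m * risk ℓ (P m) (out S)) (W.law P) :=
    integrable_finsetSum _ fun m _ => (h.integrable_risk_output P m hθ₁ hT hq).const_mul _
  have hgap_eq : ∀ S, gap S = ∑ m, p m * risk ℓ (P m) (out S) - ∑ i, w i * ℓ (out S) (S i) := by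
    intro S
    rw [← sum_weight_sigma hsize]
    simp only [gap, w, mul_sub, Finset.sum_sub_distrib]
  have hgapint : Integrable gap (W.law P) := by
    rw [funext hgap_eq]
    exact hriskout.sub hlossout
  have hoptint : Integrable opt (W.law P) := by
    simp only [opt, hglobal]
    exact hlossout.sub hlossu
  have hgap : ∫ S, gap S ∂(W.law P) ≤ _ :=
    (h.integral_gap_le hv (by simpa [Schedule.total] using hvN)
      (fun i : (m : Fin M) × Fin (W.size m) => P i.1) w houtm hout).trans
      (generalization_term_le hsize hN p hvN hB0)
  have hopt : ∫ S, opt S ∂(W.law P)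
      ≤ (constOne κ L B (Metric.diam Θ) E + constThree κ L B (Metric.diam Θ)) / √(T : ℝ)
        + Metric.diam Θ * (sigmaZero ℓ Θ P * √((M : ℝ) - (Mhist : ℝ))
            * √(∑ m ∈ Finset.univ.filter (fun m : Fin M => Mhist ≤ (m : ℕ)), p m ^ 2)) := by
    have hdev := fun t : Fin T => h.integrable_freshDev (c := c) (lam := lam) (p := p)
      (Mhist := Mhist) P t
    have hsum := (integrable_finsetSum Finset.univ fun t _ => hdev t).const_mul ((T : ℝ)⁻¹)
    have hsum' := hsum.const_mul (Metric.diam Θ)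
    refine (integral_mono hoptint ((integrable_const _).add hsum') fun S =>
      Schedule.optimization_error_le h hwt hp hagg hq hT hB0 hE hκ
        (Schedule.sigmaBar_le h hwt hp hT hB0 hagg hq P) hη hθ₁ hu S
        (roundRisk_sub_roundRisk hc hagg P S)
        (fun t a ha b hb => h.freshRisk_sub_le hp P S t ha hb)
        (freshDev_nonneg hp P S)).trans ?_
    rw [integral_add' (integrable_const _) hsum', integral_const_mul, integral_const_mul,
      integral_finsetSum _ fun t _ => hdev t, integral_const, probReal_univ, one_smul]
    refine add_le_add le_rfl (mul_le_mul_of_nonneg_left ?_ Metric.diam_nonneg)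
    rw [inv_mul_le_iff₀ (by positivity)]
    refine (Finset.sum_le_sum fun t _ => h.integral_freshDev_le P hM hc hp t).trans (le_of_eq ?_)
    simp
  -- The decomposition for a fixed dataset; in the last bracket the empirical fluctuation at `u` has
  -- mean zero, and only the discrepancy survives.
  have hpoint : ∀ S, risk ℓ (mixture α P) (out S) - ∑ m, α m * risk ℓ (P m) u
      ≤ gap S + opt S + (∑ i, w i * ℓ u (S i) - ∑ m, p m * risk ℓ (P m) u
          + 2 * maxDisc ℓ Θ P * ∑ m, |α m - p m|) := by
    intro S
    have h1 := h.excess_risk_le P hα hp m₀ (hout S) hu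
    have h2 : opt S = ∑ i, w i * ℓ (out S) (S i) - ∑ i, w i * ℓ u (S i) := by
      simp only [opt, hglobal]
    rw [h.risk_mixture P hα.1, hgap_eq, h2]
    linarith
  have hrest : ∫ S, (∑ i, w i * ℓ u (S i) - ∑ m, p m * risk ℓ (P m) u
      + 2 * maxDisc ℓ Θ P * ∑ m, |α m - p m|) ∂(W.law P)
      = 2 * maxDisc ℓ Θ P * ∑ m, |α m - p m| := by
    have hsub : Integrable (fun S : W.Dataset Z =>
        ∑ i, w i * ℓ u (S i) - ∑ m, p m * risk ℓ (P m) u) (W.law P) :=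
      hlossu.sub (integrable_const _)
    rw [integral_add hsub (integrable_const _), integral_sub hlossu (integrable_const _),
      h.integral_sum_loss P hsize]
    simp
  have hinf : ∑ m, α m * risk ℓ (P m) u ≤ ⨅ θ : Θ, risk ℓ (mixture α P) θ :=
    le_ciInf fun θ => by
      rw [h.risk_mixture P hα.1]
      exact humin θ θ.2
  have hmixint : Integrable (fun S => risk ℓ (mixture α P) (out S)) (W.law P) :=
    h.integrable_risk_mixture_output P hα.1 hθ₁ hT hq
  have hrestint : Integrable (fun S : W.Dataset Z => ∑ i, w i * ℓ u (S i)
      - ∑ m, p m * risk ℓ (P m) u + 2 * maxDisc ℓ Θ P * ∑ m, |α m - p m|) (W.law P) :=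
    (hlossu.sub (integrable_const _)).add (integrable_const _)
  have hgo : Integrable (fun S => gap S + opt S) (W.law P) := hgapint.add hoptint
  have hmain := integral_mono (hmixint.sub (integrable_const _)) (hgo.add hrestint) hpoint
  rw [integral_sub' hmixint (integrable_const _), integral_add' hgo hrestint,
    integral_add hgapint hoptint, hrest, integral_const, probReal_univ, one_smul] at hmain
  have htrue : W.trueError ℓ Θ P α η E θ₁
      ≤ ∫ S, risk ℓ (mixture α P) (out S) ∂(W.law P) - ∑ m, α m * risk ℓ (P m) u :=
    sub_le_sub_left hinf _
  linarith

end TrueError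

end FedStream

end

theorem mainTheorem5
    {d M T Mhist E v : ℕ} (hT : 0 < T) (hE : 0 < E) (hM : Mhist ≤ M)
    {Z : Type*} [MeasurableSpace Z]
    (P : Fin M → MeasureTheory.Measure Z) [∀ m, MeasureTheory.IsProbabilityMeasure (P m)]
    (Θ : Set (FedStream.Par d)) (hne : Θ.Nonempty) (hconv : Convex ℝ Θ) (hclosed : IsClosed Θ)
    (hbdd : Bornology.IsBounded Θ)
    (ℓ : FedStream.Par d → Z → ℝ) (hmeas : ∀ θ, Measurable (ℓ θ))
    (B : ℝ) (hnonneg : ∀ θ z, 0 ≤ ℓ θ z) (hB : ∀ θ ∈ Θ, ∀ z, ℓ θ z ≤ B)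
    (hcvx : ∀ z, ConvexOn ℝ Set.univ (fun θ => ℓ θ z))
    (L : NNReal) (hsmooth : ∀ z, FedStream.IsSmooth L (fun θ => ℓ θ z))
    -- the historical/fresh scenario, with aggregation weights `p` and target weights `α`
    (c : Fin M → ℕ) (hc : ∀ m, 0 < c m) (lam : Fin M → ℝ) (hlam : ∀ m, 0 ≤ lam m)
    (W : FedStream.Schedule M T) (hW : W = FedStream.histFresh T Mhist c lam)
    (p : Fin M → ℝ) (hp : p ∈ stdSimplex ℝ (Fin M)) (hagg : ∀ t m, W.aggWt t m = p m)
    (α : Fin M → ℝ) (hα : α ∈ stdSimplex ℝ (Fin M))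
    -- the VC dimension of the hypothesis class
    (hv : FedStream.hypVCDim ℓ Θ = (v : ℕ∞)) (hvN : v ≤ W.total)
    -- the learning rate; note that `1 / max 1 s` is `min {1, 1/s}`, also for `s = 0`
    (κ η : ℝ) (hκ : 0 < κ)
    (hη : η * (E : ℝ) = κ / √(T : ℝ) * (1 / max 1 (W.sigmaBar ℓ Θ P)))
    (θ₁ : FedStream.Par d) (hθ₁ : θ₁ ∈ Θ) :
    MeasureTheory.Integrable
      (fun S => FedStream.risk ℓ (FedStream.mixture α P) (W.output ℓ Θ η E θ₁ S)) (W.law P) ∧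
    W.trueError ℓ Θ P α η E θ₁ ≤
      (FedStream.constOne κ L B (Metric.diam Θ) E + FedStream.constThree κ L B (Metric.diam Θ))
          / √(T : ℝ)
        + FedStream.constTwo κ L B E / √((T : ℝ) ^ 3)
        + (Metric.diam Θ + 2 / √(T : ℝ)) * FedStream.sigmaZero ℓ Θ P * √((M : ℝ) - (Mhist : ℝ))
            * √(∑ m ∈ Finset.univ.filter (fun m : Fin M => Mhist ≤ (m : ℕ)), p m ^ 2)
        + 2 * FedStream.maxDisc ℓ Θ P * (∑ m, |α m - p m|)
        + 4 * B * √(1 + Real.log ((W.total : ℝ) / (v : ℝ))) * √((v : ℝ) / (W.total : ℝ))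
            * √(∑ m, p m ^ 2 / W.relSize m) := by
  subst hW
  have h : FedStream.IsLoss ℓ Θ B L :=
    ⟨hne, hconv, hclosed, hbdd, hmeas, hnonneg, hB, hcvx, hsmooth⟩
  refine ⟨h.integrable_risk_mixture_output P hα.1 hθ₁ hT
    (FedStream.histFresh_roundWt hp hagg hT), ?_⟩
  refine (h.trueError_le P hT hM hc hlam hp hagg hα hv.le hvN hE hκ hη hθ₁).trans ?_
  -- The bound obtained so far contains neither the `constTwo` term nor the `2 / √T` part of the
  -- noise term; both are nonnegative and can be added.
  have hE1 : (1 : ℝ) ≤ E := by exact_mod_cast hE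
  have hinv : 0 ≤ 1 - (E : ℝ)⁻¹ := sub_nonneg.2 (inv_le_one_of_one_le₀ hE1)
  have hC2 : 0 ≤ FedStream.constTwo κ L B E / √((T : ℝ) ^ 3) := by
    unfold FedStream.constTwo
    positivity
  have hσ := FedStream.sigmaZero_nonneg ℓ Θ P
  have hnoise : 0 ≤ 2 / √(T : ℝ) * (FedStream.sigmaZero ℓ Θ P * √((M : ℝ) - (Mhist : ℝ))
      * √(∑ m ∈ Finset.univ.filter (fun m : Fin M => Mhist ≤ (m : ℕ)), p m ^ 2)) := by
    positivity
  linarith
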